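/- **Setting.** Let $\Omega=(l_1,l_2)\times(l_3,l_4)$, let $\psi$ be smooth, $\Gamma_I=\{z\in\Omega:\psi(z)=0\}$, $\Omega^{\pm}=\{z\in\Omega:\pm\psi(z)>0\}$, $\Gamma_3=(l_1,l_2)\times\{l_3\}$. Let $(x_0,l_3)\in\Gamma_3$ be a point outside $\overline{\Gamma_I}$. Let the coefficient $a$ be positive and six times continuously differentiable on $\overline\Omega\setminus\overline{\Gamma_I}$, with partial derivatives of order up to six uniformly continuous in $\Omega^+$ and in $\Omega^-$. An *exact solution* is a triple $(u,f,g)$ with $u\in C^7(\overline\Omega\setminus\overline{\Gamma_I})$ whose partial derivatives of order up to seven are uniformly continuous in $\Omega^{\pm}$, $f\in C^5(\overline\Omega\setminus\overline{\Gamma_I})$, $g$ with uniformly continuous derivatives of order up to five on $(l_1,l_2)$, $-\nabla\cdot(a\nabla u)=f$ in $\Omega\setminus\Gamma_I$, and $\frac{\partial u}{\partial\vec n}=-u_y=g$ on $\Gamma_3\setminus\overline{\Gamma_I}$. The interface jumps of $u$ and of the flux, and the data on the other three sides, are arbitrary. Write $v^{(m,n)}=\partial_x^m\partial_y^n v(x_0,l_3)$,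 $g^{(n)}=g^{(n)}(x_0)$, $\Lambda_K=\{(m,n)\in\mathbb N_0^2:m+n\le K\}$, $\Lambda^{H,2}_K=\{(m,n)\in\Lambda_K:n\ge2\}$. Repeated differentiation of the equation $u_{yy}=-u_{xx}-\frac{a_x}{a}u_x-\frac{a_y}{a}u_y-\frac1af$ at $(x_0,l_3)$ gives $u^{(m',n')}=\sum_{m,\;n\in\{0,1\}}A^{u}_{m',n',m,n}u^{(m,n)}+\sum_{m,n}A^{f}_{m',n',m,n}f^{(m,n)}$ with constants $A^u,A^f$ determined by the partial derivatives of $a$ at $(x_0,l_3)$. Put $$G_{m,n}(x,y)=\sum_{\ell=0}^{\lfloor m/2\rfloor}\frac{(-1)^\ell y^{n+2\ell}x^{m-2\ell}}{(n+2\ell)!(m-2\ell)!}+\sum_{(m',n')\in\Lambda^{H,2}_6\setminus\Lambda^{H,2}_{m+n}}A^u_{m',n',m,n}\frac{x^{m'}y^{n'}}{m'!n'!}\quad(n\in\{0,1\},\ m+n\le 6),$$ $$Q_{m,n}(x,y)=\sum_{\ell=1}^{1+\lfloor m/2\rfloor}\frac{(-1)^\ell y^{n+2\ell}x^{m-2\ell+2}}{(n+2\ell)!(m-2\ell+2)!}\frac1{a^{(0,0)}}+\sum_{(m',n')\in\Lambda^{H,2}_6\setminus\Lambda^{H,2}_{m+n+2}}A^f_{m',n',m,n}\frac{x^{m'}y^{n'}}{m'!n'!}\quad((m,n)\in\Lambda_4).$$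 A *six-point scheme* at $(x_0,l_3)$ with data $(N,K)$ is an equation $$\sum_{k=-1}^1\sum_{\ell=0}^1C_{k,\ell}(h)\,u(x_0+kh,l_3+\ell h)=\sum_{(m,n)\in\Lambda_N}f^{(m,n)}C_{f,m,n}(h)+\sum_{n=0}^Kg^{(n)}C_{g,n}(h);$$ it is *nontrivial* if the $C_{k,\ell}(h)$ do not all tend to $0$ as $h\to0^+$. It has *order* $p$ if for every exact solution the difference of the two sides is $O(h^{p+1})$ as $h\to0^+$ (the left side is scaled like $h\,\partial u/\partial\vec n$). **Theorem.** 1. Let $c=(c_{k,\ell,i})_{k\in\{-1,0,1\},\ell\in\{0,1\},0\le i\le6}$ be real numbers, not all zero, such that $C_{k,\ell}(h)=\sum_{i=0}^6c_{k,\ell,i}h^i$ satisfy $$\sum_{k=-1}^1\sum_{\ell=0}^1C_{k,\ell}(h)\,G_{n,0}(kh,\ell h)=O(h^7)\quad(h\to0^+),\qquad n=0,1,\dots,6.\tag{$*$}$$ Then the six-point scheme with these $C_{k,\ell}$, with $C_{f,m,n}=\sum_{k,\ell}C_{k,\ell}Q_{m,n}(kh,\ell h)$ for $(m,n)\in\Lambda_4$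 and $C_{g,n}=-\sum_{k,\ell}C_{k,\ell}G_{n,1}(kh,\ell h)$ for $0\le n\le5$, has order six. 2. The system $(*)$ has solutions for which the $c_{k,\ell,0}$ are not all zero. 3. The largest order of a nontrivial six-point scheme with data $(N,K)=(4,5)$ is six. 4. If $a$ is smooth (it satisfies the regularity assumption for all orders) and $a_y(x_0,l_3)\neq0$, then for all $N,K$ no nontrivial six-point scheme with data $(N,K)$ has an order greater than six, even if order is tested only on exact solutions $(u,f,g)$ that are smooth (regularity of all orders). -/

import Mathlib

open Set Filter Topology Asymptotics
open scoped ContDiff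

noncomputable section

/-- A rectangle `(l₁, l₂) × (l₃, l₄)` together with a smooth level-set function `ψ`. -/
structure InterfaceDomain where
  l₁ : ℝ
  l₂ : ℝ
  l₃ : ℝ
  l₄ : ℝ
  lt₁₂ : l₁ < l₂
  lt₃₄ : l₃ < l₄
  ψ : ℝ × ℝ → ℝ
  smooth_ψ : ContDiff ℝ ∞ ψ

/-! ### Partial derivatives relative to a set

At an interior point of `S` these are the ordinary partial derivatives; at a boundary point of a
set of unique differentiability they are the derivatives from inside `S`. -/

/-- `∂v/∂x` relative to `S`. -/
def partialX (S : Set (ℝ × ℝ)) (v : ℝ × ℝ → ℝ) : ℝ × ℝ → ℝ :=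
  fun z => fderivWithin ℝ v S z (1, 0)

/-- `∂v/∂y` relative to `S`. -/
def partialY (S : Set (ℝ × ℝ)) (v : ℝ × ℝ → ℝ) : ℝ × ℝ → ℝ :=
  fun z => fderivWithin ℝ v S z (0, 1)

/-- `∂^{m+n} v / ∂x^m ∂y^n` relative to `S`. -/
def partialD (S : Set (ℝ × ℝ)) (m n : ℕ) (v : ℝ × ℝ → ℝ) : ℝ × ℝ → ℝ :=
  (partialX S)^[m] ((partialY S)^[n] v)

namespace InterfaceDomain

variable (D : InterfaceDomain)

/-- The open rectangle. -/
def Ω : Set (ℝ × ℝ) := Ioo D.l₁ D.l₂ ×ˢ Ioo D.l₃ D.l₄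

/-- The interface curve. -/
def interface : Set (ℝ × ℝ) := {z ∈ D.Ω | D.ψ z = 0}

/-- The subregion where the level-set function is positive. -/
def Ωpos : Set (ℝ × ℝ) := {z ∈ D.Ω | 0 < D.ψ z}

/-- The subregion where the level-set function is negative. -/
def Ωneg : Set (ℝ × ℝ) := {z ∈ D.Ω | D.ψ z < 0}

/-- The closed rectangle without the closure of the interface: the two open subregions together
with the part of the outer boundary that the interface does not touch. -/
def region : Set (ℝ × ℝ) := (Icc D.l₁ D.l₂ ×ˢ Icc D.l₃ D.l₄) \ closure D.interface

/-- `v` is of class `C^k` off the interface (up to the outer boundary), and its partial derivatives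
of total order at most `k` are uniformly continuous in each of the two subregions. -/
structure PiecewiseSmooth (k : ℕ∞) (v : ℝ × ℝ → ℝ) : Prop where
  contDiffOn : ContDiffOn ℝ k v D.region
  unif_pos : ∀ i j : ℕ, ((i + j : ℕ) : ℕ∞) ≤ k → UniformContinuousOn (partialD D.region i j v) D.Ωpos
  unif_neg : ∀ i j : ℕ, ((i + j : ℕ) : ℕ∞) ≤ k → UniformContinuousOn (partialD D.region i j v) D.Ωneg

/-- `u` is an exact solution of the interface problem with source `f` and Neumann data `g` on the
bottom side `(l₁, l₂) × {l₃}`, at regularity level `k`: `u` has `k + 2` derivatives, `f` and `g`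
have `k`. The data on the interface (the jumps of `u` and of the flux) and on the other three
sides are free data of the problem; they are those produced by `u` and are not named.
Uniform continuity of the derivatives of `f` follows from the equation. -/
structure IsSolution (k : ℕ∞) (a u f : ℝ × ℝ → ℝ) (g : ℝ → ℝ) : Prop where
  smooth_u : D.PiecewiseSmooth (k + 2) u
  smooth_f : ContDiffOn ℝ k f D.region
  smooth_g : ContDiffOn ℝ k g (Ioo D.l₁ D.l₂)
  unif_g : ∀ j : ℕ, (j : ℕ∞) ≤ k → UniformContinuousOn (iteratedDeriv j g) (Ioo D.l₁ D.l₂)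
  /-- `-∇ · (a ∇u) = f` off the interface. -/
  pde : ∀ z ∈ D.Ω \ D.interface,
    -(partialX D.region (fun w => a w * partialX D.region u w) z
      + partialY D.region (fun w => a w * partialY D.region u w) z) = f z
  /-- `∂u/∂n = g` on the bottom side; the outward unit normal there is `(0, -1)`. -/
  neumann : ∀ x ∈ Ioo D.l₁ D.l₂, (x, D.l₃) ∉ closure D.interface →
    fderivWithin ℝ u D.region (x, D.l₃) (0, -1) = g x

end InterfaceDomain

/-! ### The polynomials `G^H` and `Q^H` -/

/-- Pairs of nonnegative integers of sum at most `K`. -/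
def Lam (K : ℕ) : Finset (ℕ × ℕ) :=
  (Finset.range (K + 1) ×ˢ Finset.range (K + 1)).filter fun p => p.1 + p.2 ≤ K

/-- The pairs in `Lam K` with second entry at least two. -/
def LamH2 (K : ℕ) : Finset (ℕ × ℕ) := (Lam K).filter fun p => 2 ≤ p.2

/-- The partial derivatives `u^{(m,n)}` (argument order: `n`, then `m`) at a point which the
equation forces, through its own partial derivatives, from `u^{(m,0)} = d (m,0)`,
`u^{(m,1)} = d (m,1)` and `f^{(m,n)} = F (m,n)`. The equation is written as
`u_yy = -u_xx - p u_x - q u_y - s f` with `p = a_x / a`, `q = a_y / a`, `s = 1 / a`, and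
`p i j`, `q i j`, `s i j` stand for the `(i,j)`-th partial derivatives of these at the point. -/
def forcedJet (p q s : ℕ → ℕ → ℝ) (d F : ℕ × ℕ → ℝ) : ℕ → ℕ → ℝ
  | 0, m => d (m, 0)
  | 1, m => d (m, 1)
  | n + 2, m =>
      -forcedJet p q s d F n (m + 2)
        - ∑ i ∈ Finset.range (m + 1), ∑ j ∈ Finset.range (n + 1),
            (m.choose i : ℝ) * (n.choose j : ℝ) *
              (p i j * forcedJet p q s d F (n - j) (m - i + 1)
                + q i j * forcedJet p q s d F (n - j + 1) (m - i)
                + s i j * F (m - i, n - j))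
  termination_by n => n
  decreasing_by all_goals omega

section Polynomials

/- `S` is the set relative to which derivatives are taken, `z₀` the base point. -/
variable (S : Set (ℝ × ℝ)) (a : ℝ × ℝ → ℝ) (z₀ : ℝ × ℝ)

/-- `forcedJet` for the coefficient `a` at the base point `z₀`. -/
def coeffJet (d F : ℕ × ℕ → ℝ) (m n : ℕ) : ℝ :=
  forcedJet (fun i j => partialD S i j (fun z => partialX S a z / a z) z₀)
    (fun i j => partialD S i j (fun z => partialY S a z / a z) z₀)
    (fun i j => partialD S i j (fun z => 1 / a z) z₀) d F n m

/-- `A^{H,u}_{m',n',m,n}`: the coefficient of `u^{(m,n)}` (`n ≤ 1`) in `u^{(m',n')}`. -/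
def AHu (m' n' m n : ℕ) : ℝ := coeffJet S a z₀ (Pi.single (m, n) 1) 0 m' n'

/-- `A^{H,f}_{m',n',m,n}`: the coefficient of `f^{(m,n)}` in `u^{(m',n')}`. -/
def AHf (m' n' m n : ℕ) : ℝ := coeffJet S a z₀ 0 (Pi.single (m, n) 1) m' n'

/-- `G^H_{M,m,n}(x,y)`, for `n ≤ 1` and `m + n ≤ M + 1`. -/
def GH (M m n : ℕ) (x y : ℝ) : ℝ :=
  ∑ l ∈ Finset.range (m / 2 + 1),
      (-1) ^ l * y ^ (n + 2 * l) * x ^ (m - 2 * l)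
        / (((n + 2 * l).factorial : ℝ) * ((m - 2 * l).factorial : ℝ))
    + ∑ r ∈ LamH2 (M + 1) \ LamH2 (m + n),
      AHu S a z₀ r.1 r.2 m n * (x ^ r.1 * y ^ r.2 / ((r.1.factorial : ℝ) * (r.2.factorial : ℝ)))

/-- `Q^H_{M,m,n}(x,y)`, for `m + n ≤ M - 1`. -/
def QH (M m n : ℕ) (x y : ℝ) : ℝ :=
  ∑ l ∈ Finset.Icc 1 (1 + m / 2),
      (-1) ^ l * y ^ (n + 2 * l) * x ^ (m + 2 - 2 * l)
        / (((n + 2 * l).factorial : ℝ) * ((m + 2 - 2 * l).factorial : ℝ)) * (1 / a z₀)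
    + ∑ r ∈ LamH2 (M + 1) \ LamH2 (m + n + 2),
      AHf S a z₀ r.1 r.2 m n * (x ^ r.1 * y ^ r.2 / ((r.1.factorial : ℝ) * (r.2.factorial : ℝ)))

end Polynomials

/-! ### Six-point schemes -/

/-- Indices of the six stencil points: `(i, j)` stands for `k = i - 1 ∈ {-1, 0, 1}` and
`ℓ = j ∈ {0, 1}`. -/
abbrev Stencil : Type := Fin 3 × Fin 2

/-- The integer `k ∈ {-1, 0, 1}` of a stencil index, as a real number. -/
def Stencil.k (s : Stencil) : ℝ := ((s.1 : ℕ) : ℝ) - 1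

/-- The integer `ℓ ∈ {0, 1}` of a stencil index, as a real number. -/
def Stencil.l (s : Stencil) : ℝ := ((s.2 : ℕ) : ℝ)

/-- A six-point scheme
`∑ C_{k,ℓ}(h) u_{k,ℓ} = ∑ f^{(m,n)} C_{f,m,n}(h) + ∑ g^{(n)} C_{g,n}(h)`,
where all coefficients may depend on the mesh size `h`. -/
structure SixPointScheme where
  C : Stencil → ℝ → ℝ
  Cf : ℕ × ℕ → ℝ → ℝ
  Cg : ℕ → ℝ → ℝ

namespace SixPointScheme

/-- The coefficients of the unknowns do not all tend to zero as `h → 0⁺`. (This normalization is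
needed to speak of an order: multiplying a scheme by a power of `h` must not change it.) -/
def Nontrivial (σ : SixPointScheme) : Prop :=
  ¬ Tendsto (fun h s => σ.C s h) (𝓝[>] (0 : ℝ)) (𝓝 (0 : Stencil → ℝ))

/-- Left-hand side minus right-hand side at the bottom side point `(x₀, l₃)` for mesh size `h`,
with the exact solution `u` inserted. The right-hand side uses the partial derivatives of `f` of
order at most `N` and the derivatives of `g` of order at most `K`. -/
def residual (σ : SixPointScheme) (D : InterfaceDomain) (x₀ : ℝ) (N K : ℕ)
    (u f : ℝ × ℝ → ℝ) (g : ℝ → ℝ) (h : ℝ) : ℝ :=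
  ∑ s : Stencil, σ.C s h * u (x₀ + s.k * h, D.l₃ + s.l * h)
    - (∑ r ∈ Lam N, partialD D.region r.1 r.2 f (x₀, D.l₃) * σ.Cf r h
      + ∑ n ∈ Finset.range (K + 1), iteratedDeriv n g x₀ * σ.Cg n h)

/-- Accuracy of order `p` for `∂u/∂n = g` at `(x₀, l₃)`: the residual of every exact solution is
`O(h^{p+1})`. The extra power of `h` is the scaling of the scheme: with coefficients of size one,
the left-hand side is of the size of `h ∂u/∂n`. -/
def HasOrder (σ : SixPointScheme) (D : InterfaceDomain) (a : ℝ × ℝ → ℝ) (x₀ : ℝ) (k : ℕ∞)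
    (N K p : ℕ) : Prop :=
  ∀ (u f : ℝ × ℝ → ℝ) (g : ℝ → ℝ), D.IsSolution k a u f g →
    (fun h => σ.residual D x₀ N K u f g h) =O[𝓝[>] (0 : ℝ)] fun h => h ^ (p + 1)

end SixPointScheme

/-- `C_{k,ℓ}(h) = ∑_{i ≤ 6} c_{k,ℓ,i} h^i`. -/
def stencilCoeff (c : Stencil → Fin 7 → ℝ) (s : Stencil) (h : ℝ) : ℝ :=
  ∑ i : Fin 7, c s i * h ^ (i : ℕ)

/-- The linear system for the numbers `c_{k,ℓ,i}`:
`∑ C_{k,ℓ}(h) G^H_{5,n,0}(kh, ℓh) = O(h^7)` as `h → 0⁺`, for `n = 0, …, 6`. -/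
def SolvesNeumannSystem (D : InterfaceDomain) (a : ℝ × ℝ → ℝ) (x₀ : ℝ)
    (c : Stencil → Fin 7 → ℝ) : Prop :=
  ∀ n ≤ 6, (fun h : ℝ => ∑ s : Stencil,
      stencilCoeff c s h * GH D.region a (x₀, D.l₃) 5 n 0 (s.k * h) (s.l * h))
    =O[𝓝[>] (0 : ℝ)] fun h => h ^ 7

/-- The scheme built from the numbers `c_{k,ℓ,i}`. -/
def neumannScheme (D : InterfaceDomain) (a : ℝ × ℝ → ℝ) (x₀ : ℝ)
    (c : Stencil → Fin 7 → ℝ) : SixPointScheme where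
  C := stencilCoeff c
  Cf r h := ∑ s : Stencil,
    stencilCoeff c s h * QH D.region a (x₀, D.l₃) 5 r.1 r.2 (s.k * h) (s.l * h)
  Cg n h := -∑ s : Stencil,
    stencilCoeff c s h * GH D.region a (x₀, D.l₃) 5 n 1 (s.k * h) (s.l * h)

end

/-! On the stencil, `u` agrees with its Taylor polynomial of degree six up to `O(h^7)`. The equation
expresses each derivative of `u` of order at most six through `u^{(m,0)}`, `u^{(m,1)}` and
derivatives of `f`. This is a recursion on the order in `y` (`forcedJet`), linear in its data, and
the Taylor polynomials of its solutions with one unit datum are the `G` and `Q` (`GH_eq_sum`,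
`QH_eq_sum`). Since `g^{(n)} = -u^{(n,1)}`, the coefficients `Cf` and `Cg` absorb the `f` and `g`
parts exactly; what is left is the Taylor remainder and the sums that the linear system makes
`O(h^7)`.

Solvability: sort the system by powers of `h`. The part of `G_{n,0}` of degree `n` is `Re (x+iy)^n /
n!`, whatever `a` is; the part of degree `n + 1` sees only the values `p = a_x/a` and `q = a_y/a` at
the point. The coefficients at level `i` thus need prescribed moments against `Re (k+iℓ)^n / n!` for
`n ≤ 6 - i`. Level 0 is the Laplace stencil. The moments with `n ≤ 4` can be prescribed freely,
which settles the levels from 2 on. Level 1 also needs `n = 5`; on the six points `2 Re z - 5 Re z^3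
+ 3 Re z^5 = 0`, and the prescribed moments satisfy the same relation
(`sum_laplaceStencil_correctionSlice_odd`).

Upper bounds: suppose a nontrivial scheme has order at least seven, and normalize its coefficients
so that they converge along a finer filter to a nonzero vector. Polynomials with a forced jet are
exact solutions whose data the scheme does not see; they show that the limit has vanishing moments
for `n ≤ 5`, so it is a nonzero multiple of the Laplace stencil. With data `(4,5)` the polynomial
`(y-l₃)^7/7!` is invisible too, but its stencil sum is of exact size `h^7`. With arbitrary data, use
that `Re z^6 = Re z^2` on the six points: combine the forced solutions of degrees 6 and 2, divided
by `h^6` and `h^2`, so that the leading terms cancel at every point. The speed at which the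
coefficients converge then plays no role, and the next term forces `-10 q / 7 = 0`, that is `a_y =
0`. -/

noncomputable section

/-! ### Calculus of partial derivatives relative to a set -/

/-- The derivative in direction `e` relative to `S`. -/
def dirD (S : Set (ℝ × ℝ)) (e : ℝ × ℝ) (v : ℝ × ℝ → ℝ) : ℝ × ℝ → ℝ :=
  fun z => fderivWithin ℝ v S z e

section DirectionalCalculus

variable {S : Set (ℝ × ℝ)} {e : ℝ × ℝ} {v w : ℝ × ℝ → ℝ}

lemma dirD_congr (h : EqOn v w S) : EqOn (dirD S e v) (dirD S e w) S := fun z hz => by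
  simp only [dirD, fderivWithin_congr h (h hz)]

lemma dirD_iterate_congr (m : ℕ) (h : EqOn v w S) :
    EqOn ((dirD S e)^[m] v) ((dirD S e)^[m] w) S := by
  induction m generalizing v w with
  | zero => exact h
  | succ m ih =>
    rw [Function.iterate_succ_apply, Function.iterate_succ_apply]
    exact ih (dirD_congr h)

lemma contDiffOn_dirD (hS : UniqueDiffOn ℝ S) {n : ℕ} (h : ContDiffOn ℝ (n + 1 : ℕ) v S) :
    ContDiffOn ℝ n (dirD S e v) S :=
  (h.fderivWithin hS (by norm_cast)).clm_apply contDiffOn_const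

lemma contDiffOn_dirD_iterate (hS : UniqueDiffOn ℝ S) {n : ℕ} (m : ℕ)
    (h : ContDiffOn ℝ (n + m : ℕ) v S) : ContDiffOn ℝ n ((dirD S e)^[m] v) S := by
  induction m generalizing v with
  | zero => exact h
  | succ m ih =>
    rw [Function.iterate_succ_apply]
    exact ih (contDiffOn_dirD hS (by rwa [← add_assoc] at h))

lemma ContDiffOn.diffAt_of_succ {n : ℕ} (h : ContDiffOn ℝ (n + 1 : ℕ) v S) {z : ℝ × ℝ}
    (hz : z ∈ S) : DifferentiableWithinAt ℝ v S z :=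
  (h.differentiableOn (by norm_cast)) z hz

lemma dirD_linear (hS : UniqueDiffOn ℝ S) {n : ℕ} (hv : ContDiffOn ℝ (n + 1 : ℕ) v S)
    (hw : ContDiffOn ℝ (n + 1 : ℕ) w S) (b c : ℝ) :
    EqOn (dirD S e fun z => b * v z + c * w z) (fun z => b * dirD S e v z + c * dirD S e w z) S :=
  fun z hz => by
    have h1 := hv.diffAt_of_succ hz
    have h2 := hw.diffAt_of_succ hz
    simp only [dirD]
    rw [fderivWithin_fun_add (hS z hz) (h1.const_mul b) (h2.const_mul c),
      fderivWithin_const_mul (hS z hz) h1, fderivWithin_const_mul (hS z hz) h2]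
    simp

lemma dirD_mul (hS : UniqueDiffOn ℝ S) {n : ℕ} (hv : ContDiffOn ℝ (n + 1 : ℕ) v S)
    (hw : ContDiffOn ℝ (n + 1 : ℕ) w S) :
    EqOn (dirD S e fun z => v z * w z) (fun z => v z * dirD S e w z + dirD S e v z * w z) S :=
  fun z hz => by
    simp only [dirD]
    rw [fderivWithin_fun_mul (hS z hz) (hv.diffAt_of_succ hz) (hw.diffAt_of_succ hz)]
    simp [mul_comm]

lemma dirD_iterate_linear (hS : UniqueDiffOn ℝ S) (m : ℕ) (hv : ContDiffOn ℝ m v S)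
    (hw : ContDiffOn ℝ m w S) (b c : ℝ) :
    EqOn ((dirD S e)^[m] fun z => b * v z + c * w z)
      (fun z => b * (dirD S e)^[m] v z + c * (dirD S e)^[m] w z) S := by
  induction m generalizing v w with
  | zero => exact fun z _ => rfl
  | succ m ih =>
    simp only [Function.iterate_succ_apply]
    exact (dirD_iterate_congr m (dirD_linear hS hv hw b c)).trans
      (ih (contDiffOn_dirD hS hv) (contDiffOn_dirD hS hw))

lemma dirD_iterate_add (hS : UniqueDiffOn ℝ S) (m : ℕ) (hv : ContDiffOn ℝ m v S)
    (hw : ContDiffOn ℝ m w S) :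
    EqOn ((dirD S e)^[m] fun z => v z + w z)
      (fun z => (dirD S e)^[m] v z + (dirD S e)^[m] w z) S := by
  simpa using dirD_iterate_linear (e := e) hS m hv hw 1 1

lemma dirD_iterate_zero_fun (m : ℕ) : (dirD S e)^[m] (fun _ => 0) = fun _ => 0 := by
  induction m with
  | zero => rfl
  | succ m ih =>
    rw [Function.iterate_succ_apply]
    rw [show dirD S e (fun _ => 0) = fun _ => 0 by ext z; simp [dirD]]
    exact ih

lemma dirD_iterate_sum (hS : UniqueDiffOn ℝ S) (m : ℕ) {ι : Type*} (s : Finset ι)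
    (b : ι → ℝ) (V : ι → ℝ × ℝ → ℝ) (hV : ∀ i ∈ s, ContDiffOn ℝ m (V i) S) :
    EqOn ((dirD S e)^[m] fun z => ∑ i ∈ s, b i * V i z)
      (fun z => ∑ i ∈ s, b i * (dirD S e)^[m] (V i) z) S := by
  classical
  induction s using Finset.induction_on with
  | empty => simp [dirD_iterate_zero_fun, EqOn]
  | insert i s hi ih =>
    have h1 : ContDiffOn ℝ m (fun z => ∑ i ∈ s, b i * V i z) S :=
      ContDiffOn.sum fun j hj => contDiffOn_const.mul (hV j (Finset.mem_insert_of_mem hj))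
    have h2 := dirD_iterate_linear (e := e) hS m (hV i (Finset.mem_insert_self i s)) h1 (b i) 1
    simp only [Finset.sum_insert hi]
    simp only [one_mul] at h2
    refine h2.trans fun z hz => ?_
    simp only
    rw [ih (fun j hj => hV j (Finset.mem_insert_of_mem hj)) hz]

lemma dirD_iterate_mul (hS : UniqueDiffOn ℝ S) (m : ℕ) (hv : ContDiffOn ℝ m v S)
    (hw : ContDiffOn ℝ m w S) :
    EqOn ((dirD S e)^[m] fun z => v z * w z)
      (fun z => ∑ i ∈ Finset.range (m + 1),
        (m.choose i : ℝ) * ((dirD S e)^[i] v z * (dirD S e)^[m - i] w z)) S := by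
  induction m generalizing v w with
  | zero => intro z _; simp
  | succ m ih =>
    intro z hz
    have hv' : ContDiffOn ℝ m v S := hv.of_le (by norm_cast; omega)
    have hw' : ContDiffOn ℝ m w S := hw.of_le (by norm_cast; omega)
    have hXv := contDiffOn_dirD (e := e) hS hv
    have hXw := contDiffOn_dirD (e := e) hS hw
    rw [Function.iterate_succ_apply, dirD_iterate_congr m (dirD_mul hS hv hw) hz,
      dirD_iterate_add hS m (hv'.mul hXw) (hXv.mul hw') hz]
    simp only
    rw [ih hv' hXw hz, ih hXv hw' hz,
      Finset.sum_choose_succ_mul fun i j => (dirD S e)^[i] v z * (dirD S e)^[j] w z]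
    congr 1
    refine Finset.sum_congr rfl fun i hi => ?_
    rw [← Function.iterate_succ_apply, Nat.succ_eq_add_one,
      Nat.sub_add_comm (Nat.lt_succ_iff.mp (Finset.mem_range.mp hi))]

/-- Symmetry of the second derivative passes from interior points to their limits; `hcl` makes it
available at the boundary points of `S`, where the scheme is centred. -/
lemma dirD_comm (hS : UniqueDiffOn ℝ S) (hcl : S ⊆ closure (interior S)) (e e' : ℝ × ℝ) {n : ℕ}
    (hv : ContDiffOn ℝ (n + 2 : ℕ) v S) :
    EqOn (dirD S e (dirD S e' v)) (dirD S e' (dirD S e v)) S := fun z hz => by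
  have hd : DifferentiableWithinAt ℝ (fderivWithin ℝ v S) S z :=
    ((hv.fderivWithin hS (m := 1) (by norm_cast; omega)).differentiableOn (by norm_num)) z hz
  have key : ∀ c d : ℝ × ℝ, dirD S c (dirD S d v) z
      = fderivWithin ℝ (fderivWithin ℝ v S) S z c d := fun c d => by
    change fderivWithin ℝ (fun y => fderivWithin ℝ v S y d) S z c = _
    rw [fderivWithin_clm_apply (hS z hz) hd (differentiableWithinAt_const d)]
    simp
  rw [key, key]
  exact ((hv z hz).isSymmSndFDerivWithinAt
    (by rw [minSmoothness_of_isRCLikeNormedField]; norm_cast; omega) hS (hcl hz) hz).eq _ _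

lemma dirD_iterate_comm (hS : UniqueDiffOn ℝ S) (hcl : S ⊆ closure (interior S)) (e e' : ℝ × ℝ)
    (m : ℕ) (hv : ContDiffOn ℝ (m + 1 : ℕ) v S) :
    EqOn ((dirD S e)^[m] (dirD S e' v)) (dirD S e' ((dirD S e)^[m] v)) S := by
  induction m generalizing v with
  | zero => exact fun z _ => rfl
  | succ m ih =>
    simp only [Function.iterate_succ_apply]
    exact (dirD_iterate_congr m (dirD_comm hS hcl e e' hv)).trans (ih (contDiffOn_dirD hS hv))

end DirectionalCalculus

section PartialCalculus

variable {S : Set (ℝ × ℝ)} {v w : ℝ × ℝ → ℝ}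

lemma partialX_eq_dirD (S : Set (ℝ × ℝ)) : partialX S = dirD S (1, 0) := rfl

lemma partialY_eq_dirD (S : Set (ℝ × ℝ)) : partialY S = dirD S (0, 1) := rfl

lemma partialD_zero_zero : partialD S 0 0 v = v := rfl

lemma partialD_succ_right (m n : ℕ) : partialD S m (n + 1) v = partialD S m n (partialY S v) := by
  simp [partialD]

lemma partialD_succ_left (m n : ℕ) : partialD S (m + 1) n v = partialX S (partialD S m n v) := by
  simp [partialD, Function.iterate_succ_apply']

lemma partialD_congr (m n : ℕ) (h : EqOn v w S) : EqOn (partialD S m n v) (partialD S m n w) S :=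
  dirD_iterate_congr m (dirD_iterate_congr n h)

lemma contDiffOn_partialX (hS : UniqueDiffOn ℝ S) {n : ℕ} (h : ContDiffOn ℝ (n + 1 : ℕ) v S) :
    ContDiffOn ℝ n (partialX S v) S := contDiffOn_dirD hS h

lemma contDiffOn_partialY (hS : UniqueDiffOn ℝ S) {n : ℕ} (h : ContDiffOn ℝ (n + 1 : ℕ) v S) :
    ContDiffOn ℝ n (partialY S v) S := contDiffOn_dirD hS h

lemma contDiffOn_partialD (hS : UniqueDiffOn ℝ S) {l : ℕ} (m n : ℕ)
    (h : ContDiffOn ℝ (l + m + n : ℕ) v S) : ContDiffOn ℝ l (partialD S m n v) S :=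
  contDiffOn_dirD_iterate hS m (contDiffOn_dirD_iterate hS n h)

lemma partialD_linear (hS : UniqueDiffOn ℝ S) (m n : ℕ) (hv : ContDiffOn ℝ (m + n : ℕ) v S)
    (hw : ContDiffOn ℝ (m + n : ℕ) w S) (b c : ℝ) :
    EqOn (partialD S m n fun z => b * v z + c * w z)
      (fun z => b * partialD S m n v z + c * partialD S m n w z) S :=
  (dirD_iterate_congr m (dirD_iterate_linear hS n (hv.of_le (by norm_cast; omega))
    (hw.of_le (by norm_cast; omega)) b c)).trans
    (dirD_iterate_linear hS m (contDiffOn_dirD_iterate hS n hv)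
      (contDiffOn_dirD_iterate hS n hw) b c)

lemma partialD_mul (hS : UniqueDiffOn ℝ S) (m n : ℕ) (hv : ContDiffOn ℝ (m + n : ℕ) v S)
    (hw : ContDiffOn ℝ (m + n : ℕ) w S) :
    EqOn (partialD S m n fun z => v z * w z)
      (fun z => ∑ i ∈ Finset.range (m + 1), ∑ j ∈ Finset.range (n + 1),
        (m.choose i : ℝ) * (n.choose j : ℝ) *
          (partialD S i j v z * partialD S (m - i) (n - j) w z)) S := by
  intro z hz
  have hle : ∀ j ≤ n, ContDiffOn ℝ m ((partialY S)^[j] v) S := fun j hj =>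
    contDiffOn_dirD_iterate hS j (hv.of_le (by norm_cast; omega))
  have hle' : ∀ j ≤ n, ContDiffOn ℝ m ((partialY S)^[j] w) S := fun j hj =>
    contDiffOn_dirD_iterate hS j (hw.of_le (by norm_cast; omega))
  have h1 : EqOn ((partialY S)^[n] fun z => v z * w z) (fun z => ∑ j ∈ Finset.range (n + 1),
        (n.choose j : ℝ) * ((partialY S)^[j] v z * (partialY S)^[n - j] w z)) S :=
    dirD_iterate_mul hS n (hv.of_le (by norm_cast; omega)) (hw.of_le (by norm_cast; omega))
  have h2 := dirD_iterate_sum (e := (1, 0)) hS m (Finset.range (n + 1)) (fun j => (n.choose j : ℝ))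
    (fun j z => (partialY S)^[j] v z * (partialY S)^[n - j] w z) (fun j hj =>
      (hle j (Nat.lt_succ_iff.mp (Finset.mem_range.mp hj))).mul (hle' (n - j) (Nat.sub_le n j)))
  rw [partialD, partialX_eq_dirD, dirD_iterate_congr m h1 hz, h2 hz]
  simp only
  rw [Finset.sum_comm]
  refine Finset.sum_congr rfl fun j hj => ?_
  rw [dirD_iterate_mul hS m (hle j (Nat.lt_succ_iff.mp (Finset.mem_range.mp hj)))
    (hle' (n - j) (Nat.sub_le n j)) hz, Finset.mul_sum]
  refine Finset.sum_congr rfl fun i _ => ?_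
  simp only [partialD, partialX_eq_dirD]
  ring

lemma partialD_partialX (hS : UniqueDiffOn ℝ S) (hcl : S ⊆ closure (interior S)) (m n : ℕ)
    (hv : ContDiffOn ℝ (m + n + 1 : ℕ) v S) :
    EqOn (partialD S m n (partialX S v)) (partialD S (m + 1) n v) S := by
  have h := dirD_iterate_congr (e := (1, 0)) m (dirD_iterate_comm hS hcl (0, 1) (1, 0) n
    (hv.of_le (by norm_cast; omega)))
  intro z hz
  have := h hz
  rw [← Function.iterate_succ_apply] at this
  exact this

end PartialCalculus

/-! ### Algebra of forced jets -/

section ForcedJet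

variable (p q s : ℕ → ℕ → ℝ)

lemma forcedJet_zero (d F : ℕ × ℕ → ℝ) (m : ℕ) : forcedJet p q s d F 0 m = d (m, 0) := by
  rw [forcedJet]

lemma forcedJet_one (d F : ℕ × ℕ → ℝ) (m : ℕ) : forcedJet p q s d F 1 m = d (m, 1) := by
  rw [forcedJet]

lemma forcedJet_add_two (d F : ℕ × ℕ → ℝ) (n m : ℕ) :
    forcedJet p q s d F (n + 2) m = -forcedJet p q s d F n (m + 2)
        - ∑ i ∈ Finset.range (m + 1), ∑ j ∈ Finset.range (n + 1),
            (m.choose i : ℝ) * (n.choose j : ℝ) *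
              (p i j * forcedJet p q s d F (n - j) (m - i + 1)
                + q i j * forcedJet p q s d F (n - j + 1) (m - i)
                + s i j * F (m - i, n - j)) := by
  rw [forcedJet]

variable {p q s}

/-- An array which satisfies the recursion up to total order `K + 2` is the forced jet. -/
lemma eq_forcedJet_of_recursion {K : ℕ} {J : ℕ → ℕ → ℝ} {d F : ℕ × ℕ → ℝ}
    (h0 : ∀ m, m ≤ K + 2 → J m 0 = d (m, 0)) (h1 : ∀ m, m + 1 ≤ K + 2 → J m 1 = d (m, 1))
    (h2 : ∀ m n, m + n ≤ K → J m (n + 2) = -J (m + 2) n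
        - ∑ i ∈ Finset.range (m + 1), ∑ j ∈ Finset.range (n + 1),
            (m.choose i : ℝ) * (n.choose j : ℝ) *
              (p i j * J (m - i + 1) (n - j) + q i j * J (m - i) (n - j + 1)
                + s i j * F (m - i, n - j))) :
    ∀ m n, m + n ≤ K + 2 → J m n = forcedJet p q s d F n m := by
  intro m n
  induction n using Nat.strong_induction_on generalizing m with
  | _ n ih =>
    intro hmn
    match n, ih, hmn with
    | 0, _, hmn => rw [forcedJet_zero, h0 m (by omega)]
    | 1, _, hmn => rw [forcedJet_one, h1 m (by omega)]
    | n + 2, ih, hmn =>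
      rw [forcedJet_add_two, h2 m n (by omega), ih n (by omega) (m + 2) (by omega)]
      congr 1
      refine Finset.sum_congr rfl fun i hi => Finset.sum_congr rfl fun j hj => ?_
      rw [Finset.mem_range] at hi hj
      rw [ih (n - j) (by omega) _ (by omega), ih (n - j + 1) (by omega) _ (by omega)]

/-- Up to total order `K + 2` the recursion reads `d` only in rows 0 and 1 and `F` only up to order
`K`, so the jet of `(d, F)` also solves the recursion of `(d', F')`. -/
lemma forcedJet_congr {K : ℕ} {d d' F F' : ℕ × ℕ → ℝ} (hd : ∀ r : ℕ × ℕ, r.2 ≤ 1 →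
    r.1 + r.2 ≤ K + 2 → d r = d' r) (hF : ∀ r : ℕ × ℕ, r.1 + r.2 ≤ K → F r = F' r) {m n : ℕ}
    (hmn : m + n ≤ K + 2) : forcedJet p q s d F n m = forcedJet p q s d' F' n m := by
  refine eq_forcedJet_of_recursion (J := fun m n => forcedJet p q s d F n m) (K := K)
    (fun m hm => ?_) (fun m hm => ?_) (fun m n hmn => ?_) m n hmn
  · rw [forcedJet_zero, hd (m, 0) (by simp) (by simpa using hm)]
  · rw [forcedJet_one, hd (m, 1) (by simp) (by simpa using hm)]
  · rw [forcedJet_add_two]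
    congr 1
    refine Finset.sum_congr rfl fun i hi => Finset.sum_congr rfl fun j hj => ?_
    rw [hF (m - i, n - j) (by dsimp only; omega)]

/-- By uniqueness: the recursion is linear, so a combination of forced jets solves the recursion of
the combined data. -/
lemma forcedJet_linear (b c : ℝ) (d d' F F' : ℕ × ℕ → ℝ) (m n : ℕ) :
    forcedJet p q s (fun r => b * d r + c * d' r) (fun r => b * F r + c * F' r) n m
      = b * forcedJet p q s d F n m + c * forcedJet p q s d' F' n m := by
  symm
  refine eq_forcedJet_of_recursion (K := m + n)
    (J := fun m n => b * forcedJet p q s d F n m + c * forcedJet p q s d' F' n m)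
    (fun m _ => ?_) (fun m _ => ?_) (fun m n _ => ?_) m n (by omega)
  · simp only [forcedJet_zero]
  · simp only [forcedJet_one]
  · have h : ∀ A B S₁ S₂ S₃ : ℝ, S₃ = b * S₁ + c * S₂ →
        b * (-A - S₁) + c * (-B - S₂) = -(b * A + c * B) - S₃ := by
      intro A B S₁ S₂ S₃ h
      rw [h]
      ring
    simp only [forcedJet_add_two]
    refine h _ _ _ _ _ ?_
    simp only [Finset.mul_sum, ← Finset.sum_add_distrib]
    refine Finset.sum_congr rfl fun i _ => Finset.sum_congr rfl fun j _ => ?_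
    ring

lemma forcedJet_zero_data (m n : ℕ) : forcedJet p q s 0 0 n m = 0 := by
  have := forcedJet_linear (p := p) (q := q) (s := s) 0 0 0 0 0 0 m n
  simpa [Pi.zero_def] using this

lemma forcedJet_sum {ι : Type*} (t : Finset ι) (c : ι → ℝ) (d F : ι → ℕ × ℕ → ℝ) (m n : ℕ) :
    forcedJet p q s (fun r => ∑ i ∈ t, c i * d i r) (fun r => ∑ i ∈ t, c i * F i r) n m
      = ∑ i ∈ t, c i * forcedJet p q s (d i) (F i) n m := by
  classical
  induction t using Finset.induction_on with
  | empty => simpa [Pi.zero_def] using forcedJet_zero_data m n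
  | insert i t hi ih =>
    have := forcedJet_linear (p := p) (q := q) (s := s) (c i) 1 (d i)
      (fun r => ∑ i ∈ t, c i * d i r) (F i) (fun r => ∑ i ∈ t, c i * F i r) m n
    simp only [one_mul] at this
    simp only [Finset.sum_insert hi, this, ih]

/-- Forced jets depend linearly on the data which they see. -/
lemma forcedJet_expand {K : ℕ} (d F : ℕ × ℕ → ℝ) {m n : ℕ} (hmn : m + n ≤ K + 2) :
    forcedJet p q s d F n m
      = ∑ r ∈ (Lam (K + 2)).filter (fun r => r.2 ≤ 1), d r * forcedJet p q s (Pi.single r 1) 0 n m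
        + ∑ r ∈ Lam K, F r * forcedJet p q s 0 (Pi.single r 1) n m := by
  have hmem : ∀ (N : ℕ) (r : ℕ × ℕ), r ∈ Lam N ↔ r.1 + r.2 ≤ N := fun N r => by
    simp only [Lam, Finset.mem_filter, Finset.mem_product, Finset.mem_range]; omega
  rw [forcedJet_congr (d' := fun r' => ∑ r ∈ (Lam (K + 2)).filter (fun r => r.2 ≤ 1),
      d r * (Pi.single r 1 : ℕ × ℕ → ℝ) r')
      (F' := fun r' => ∑ r ∈ Lam K, F r * (Pi.single r 1 : ℕ × ℕ → ℝ) r') (K := K) ?_ ?_ hmn]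
  · have h := forcedJet_linear (p := p) (q := q) (s := s) 1 1
      (fun r' => ∑ r ∈ (Lam (K + 2)).filter (fun r => r.2 ≤ 1),
        d r * (Pi.single r 1 : ℕ × ℕ → ℝ) r') 0 0
      (fun r' => ∑ r ∈ Lam K, F r * (Pi.single r 1 : ℕ × ℕ → ℝ) r') m n
    simp only [one_mul, Pi.zero_apply, add_zero, zero_add] at h
    rw [h]
    congr 1
    · have := forcedJet_sum (p := p) (q := q) (s := s)
        ((Lam (K + 2)).filter (fun r => r.2 ≤ 1)) d (fun r => Pi.single r 1) 0 m n
      simpa [Pi.zero_def] using this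
    · have := forcedJet_sum (p := p) (q := q) (s := s) (Lam K) F 0 (fun r => Pi.single r 1) m n
      simpa [Pi.zero_def] using this
  · intro r hr hr'
    simp [Pi.single_apply, Finset.sum_ite_eq, hmem, hr, hr']
  · intro r hr
    simp [Pi.single_apply, Finset.sum_ite_eq, hmem, hr]

/-- No entry depends on entries of higher total order, nor on source derivatives of order more than
its own minus two, so vanishing data below order `K` leave nothing there. -/
lemma forcedJet_eq_zero_of_lt {K : ℕ} {d F : ℕ × ℕ → ℝ}
    (hd : ∀ r : ℕ × ℕ, r.2 ≤ 1 → r.1 + r.2 < K → d r = 0)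
    (hF : ∀ r : ℕ × ℕ, r.1 + r.2 + 2 < K → F r = 0) {m n : ℕ} (hmn : m + n < K) :
    forcedJet p q s d F n m = 0 := by
  induction n using Nat.strong_induction_on generalizing m with
  | _ n ih =>
    match n, ih, hmn with
    | 0, _, hmn => rw [forcedJet_zero, hd _ (by simp) (by simpa using hmn)]
    | 1, _, hmn => rw [forcedJet_one, hd _ (by simp) (by simpa using hmn)]
    | n + 2, ih, hmn =>
      rw [forcedJet_add_two, ih n (by omega) (by omega), Finset.sum_eq_zero, neg_zero, sub_zero]
      intro i hi
      refine Finset.sum_eq_zero fun j hj => ?_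
      rw [Finset.mem_range] at hi hj
      rw [ih (n - j) (by omega) (by omega), ih (n - j + 1) (by omega) (by omega),
        hF _ (by dsimp only; omega)]
      ring

/-- In the lowest order only the principal part of the equation is seen. -/
lemma forcedJet_principal {K : ℕ} {d F : ℕ × ℕ → ℝ}
    (hd : ∀ r : ℕ × ℕ, r.2 ≤ 1 → r.1 + r.2 < K → d r = 0)
    (hF : ∀ r : ℕ × ℕ, r.1 + r.2 + 2 < K → F r = 0) {m n : ℕ} (hmn : m + n + 2 = K) :
    forcedJet p q s d F (n + 2) m = -forcedJet p q s d F n (m + 2) - s 0 0 * F (m, n) := by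
  rw [forcedJet_add_two]
  congr 1
  -- Even for `i = j = 0` the entries multiplied by `p` and `q` have order `K - 1` and vanish; the
  -- source term with `i = j = 0` is the only survivor.
  rw [Finset.sum_eq_single 0, Finset.sum_eq_single 0]
  · rw [forcedJet_eq_zero_of_lt hd hF (by omega), forcedJet_eq_zero_of_lt hd hF (by omega)]
    simp
  · intro j hj hj0
    rw [Finset.mem_range] at hj
    rw [forcedJet_eq_zero_of_lt hd hF (by omega), forcedJet_eq_zero_of_lt hd hF (by omega),
      hF _ (by dsimp only; omega)]
    ring
  · simp
  · intro i hi hi0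
    rw [Finset.mem_range] at hi
    refine Finset.sum_eq_zero fun j hj => ?_
    rw [Finset.mem_range] at hj
    rw [forcedJet_eq_zero_of_lt hd hF (by omega), forcedJet_eq_zero_of_lt hd hF (by omega),
      hF _ (by dsimp only; omega)]
    ring
  · simp

/-- In the second lowest order the lower order coefficients are seen through their values. -/
lemma forcedJet_subprincipal {K : ℕ} {d : ℕ × ℕ → ℝ}
    (hd : ∀ r : ℕ × ℕ, r.2 ≤ 1 → r.1 + r.2 < K → d r = 0) {m n : ℕ} (hmn : m + n + 1 = K) :
    forcedJet p q s d 0 (n + 2) m = -forcedJet p q s d 0 n (m + 2)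
      - (p 0 0 * forcedJet p q s d 0 n (m + 1) + q 0 0 * forcedJet p q s d 0 (n + 1) m) := by
  have hF : ∀ r : ℕ × ℕ, r.1 + r.2 + 2 < K → (0 : ℕ × ℕ → ℝ) r = 0 := fun _ _ => rfl
  rw [forcedJet_add_two]
  congr 1
  rw [Finset.sum_eq_single 0, Finset.sum_eq_single 0]
  · simp
  · intro j hj hj0
    rw [Finset.mem_range] at hj
    rw [forcedJet_eq_zero_of_lt hd hF (by omega), forcedJet_eq_zero_of_lt hd hF (by omega)]
    simp
  · simp
  · intro i hi hi0
    rw [Finset.mem_range] at hi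
    refine Finset.sum_eq_zero fun j hj => ?_
    rw [Finset.mem_range] at hj
    rw [forcedJet_eq_zero_of_lt hd hF (by omega), forcedJet_eq_zero_of_lt hd hF (by omega)]
    simp
  · simp

end ForcedJet

/-! ### The polynomials `G^H` and `Q^H` as sums of forced jets -/

lemma mem_Lam {N : ℕ} {r : ℕ × ℕ} : r ∈ Lam N ↔ r.1 + r.2 ≤ N := by
  simp only [Lam, Finset.mem_filter, Finset.mem_product, Finset.mem_range]; omega

lemma mem_LamH2 {N : ℕ} {r : ℕ × ℕ} : r ∈ LamH2 N ↔ r.1 + r.2 ≤ N ∧ 2 ≤ r.2 := by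
  simp only [LamH2, Finset.mem_filter, mem_Lam]

section JetPolynomials

variable (p q s : ℕ → ℕ → ℝ)

lemma single_data_eq_zero {m n K : ℕ} (h : K ≤ m + n) (r : ℕ × ℕ) (hr : r.1 + r.2 < K) :
    (Pi.single (m, n) 1 : ℕ × ℕ → ℝ) r = 0 := by
  rw [Pi.single_apply, if_neg]
  rintro rfl
  simp only at hr
  omega

/-- The part of a forced jet with data `u^{(m,n)} = 1` which does not depend on the lower order
terms of the equation. -/
lemma forcedJet_single_u {m n : ℕ} (hn : n ≤ 1) {r : ℕ × ℕ} (hr : r.1 + r.2 ≤ m + n ∨ r.2 ≤ 1) :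
    forcedJet p q s (Pi.single (m, n) 1) 0 r.2 r.1
      = ∑ l ∈ Finset.range (m / 2 + 1), if r = (m - 2 * l, n + 2 * l) then (-1) ^ l else 0 := by
  have hd := single_data_eq_zero (le_refl (m + n))
  have hF : ∀ r : ℕ × ℕ, r.1 + r.2 + 2 < m + n → (0 : ℕ × ℕ → ℝ) r = 0 := fun _ _ => rfl
  obtain ⟨m', n'⟩ := r
  simp only at hr ⊢
  -- Rows 0 and 1 contain the data themselves, and only the summand `l = 0` can fall into them.
  have h01 : n' ≤ 1 → (Pi.single (m, n) 1 : ℕ × ℕ → ℝ) (m', n') = ∑ l ∈ Finset.range (m / 2 + 1),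
      if (m', n') = (m - 2 * l, n + 2 * l) then (-1) ^ l else 0 := by
    intro hn'
    rw [Finset.sum_eq_single 0]
    · simp [Pi.single_apply]
    · intro l _ hl
      rw [if_neg]
      rw [Prod.mk.injEq]
      omega
    · simp
  rcases Nat.lt_or_ge 1 n' with hn' | hn'
  swap
  · rw [← h01 hn']
    interval_cases n'
    · rw [forcedJet_zero]
    · rw [forcedJet_one]
  replace hr : m' + n' ≤ m + n := by omega
  rcases hr.lt_or_eq with hlt | heq
  · rw [forcedJet_eq_zero_of_lt (fun r _ hr => hd r hr) hF hlt, Finset.sum_eq_zero]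
    intro l hl
    rw [Finset.mem_range] at hl
    rw [if_neg]
    rw [Prod.mk.injEq]
    omega
  · clear hn'
    induction n' using Nat.strong_induction_on generalizing m' with
    | _ n' ih =>
      match n', ih, heq with
      | 0, _, _ => rw [forcedJet_zero, h01 (by omega)]
      | 1, _, _ => rw [forcedJet_one, h01 (by omega)]
      | n' + 2, ih, heq =>
        -- The principal recursion moves summand `l` to `l + 1`. The unmatched end terms, `l = m /
        -- 2` before the shift and `l = 0` after it, sit at other indices and vanish.
        rw [forcedJet_principal (fun r _ hr => hd r hr) hF (by omega),
          ih n' (by omega) (m' + 2) ?_ (by omega) (by omega), Finset.sum_range_succ, if_neg,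
          Finset.sum_range_succ', if_neg]
        · simp only [Pi.zero_apply, mul_zero, sub_zero, add_zero, ← Finset.sum_neg_distrib]
          refine Finset.sum_congr rfl fun l hl => ?_
          rw [Finset.mem_range] at hl
          have : (m' + 2, n') = (m - 2 * l, n + 2 * l)
              ↔ (m', n' + 2) = (m - 2 * (l + 1), n + 2 * (l + 1)) := by
            simp only [Prod.mk.injEq]; omega
          simp only [this]
          split_ifs <;> ring
        · simp only [Prod.mk.injEq]; omega
        · simp only [Prod.mk.injEq]; omega
        · intro hn'
          rw [Finset.sum_eq_single 0]
          · simp [Pi.single_apply]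
          · intro l _ hl
            rw [if_neg]
            rw [Prod.mk.injEq]
            omega
          · simp

/-- The part of a forced jet with data `f^{(m,n)} = 1` which does not depend on the lower order
terms of the equation. -/
lemma forcedJet_single_f {m n : ℕ} {r : ℕ × ℕ} (hr : r.1 + r.2 ≤ m + n + 2 ∨ r.2 ≤ 1) :
    forcedJet p q s 0 (Pi.single (m, n) 1) r.2 r.1
      = ∑ l ∈ Finset.range (m / 2 + 1),
        if r = (m - 2 * l, n + 2 * l + 2) then (-1) ^ (l + 1) * s 0 0 else 0 := by
  have hF : ∀ r : ℕ × ℕ, r.1 + r.2 + 2 < m + n + 2 → (Pi.single (m, n) 1 : ℕ × ℕ → ℝ) r = 0 :=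
    fun r hr => single_data_eq_zero (le_refl (m + n)) r (by omega)
  have hd : ∀ r : ℕ × ℕ, r.2 ≤ 1 → r.1 + r.2 < m + n + 2 → (0 : ℕ × ℕ → ℝ) r = 0 :=
    fun _ _ _ => rfl
  obtain ⟨m', n'⟩ := r
  simp only at hr ⊢
  have hzero : ∀ m' n' : ℕ, n' ≤ 1 ∨ m' + n' < m + n + 2 →
      (0 : ℝ) = ∑ l ∈ Finset.range (m / 2 + 1),
        if (m', n') = (m - 2 * l, n + 2 * l + 2) then (-1) ^ (l + 1) * s 0 0 else 0 := by
    intro m' n' h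
    rw [Finset.sum_eq_zero]
    intro l hl
    rw [Finset.mem_range] at hl
    rw [if_neg]
    rw [Prod.mk.injEq]
    omega
  rcases Nat.lt_or_ge 1 n' with hn' | hn'
  swap
  · rw [← hzero _ _ (Or.inl hn')]
    interval_cases n'
    · rw [forcedJet_zero]; rfl
    · rw [forcedJet_one]; rfl
  replace hr : m' + n' ≤ m + n + 2 := by omega
  rcases hr.lt_or_eq with hlt | heq
  · rw [forcedJet_eq_zero_of_lt hd hF hlt, ← hzero _ _ (Or.inr hlt)]
  · clear hn'
    induction n' using Nat.strong_induction_on generalizing m' with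
    | _ n' ih =>
      match n', ih, heq with
      | 0, _, _ => rw [forcedJet_zero, ← hzero _ _ (by omega)]; rfl
      | 1, _, _ => rw [forcedJet_one, ← hzero _ _ (by omega)]; rfl
      | n' + 2, ih, heq =>
        have h1 : s 0 0 * (Pi.single (m, n) 1 : ℕ × ℕ → ℝ) (m', n')
            = if (m', n' + 2) = (m - 2 * 0, n + 2 * 0 + 2) then s 0 0 else 0 := by
          simp [Pi.single_apply]
        rw [forcedJet_principal hd hF (by omega), ih n' (by omega) (m' + 2) (by omega)
            (by omega), h1,
          Finset.sum_range_succ, if_neg, Finset.sum_range_succ', add_zero,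
          ← Finset.sum_neg_distrib, sub_eq_add_neg]
        · congr 1
          · refine Finset.sum_congr rfl fun l hl => ?_
            rw [Finset.mem_range] at hl
            have : (m' + 2, n') = (m - 2 * l, n + 2 * l + 2)
                ↔ (m', n' + 2) = (m - 2 * (l + 1), n + 2 * (l + 1) + 2) := by
              simp only [Prod.mk.injEq]; omega
            simp only [this]
            split_ifs <;> ring
          · split_ifs <;> simp
        · simp only [Prod.mk.injEq]; omega

end JetPolynomials

/-- The monomial `x^m y^n / (m! n!)`. -/
def taylorMonomial (r : ℕ × ℕ) (x y : ℝ) : ℝ :=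
  x ^ r.1 * y ^ r.2 / ((r.1.factorial : ℝ) * (r.2.factorial : ℝ))

section Polynomials

variable (S : Set (ℝ × ℝ)) (a : ℝ × ℝ → ℝ) (z₀ : ℝ × ℝ)

lemma sum_ite_eq_taylorMonomial {ι : Type*} (t : Finset ι) (φ : ι → ℕ × ℕ) (c : ι → ℝ)
    (T : Finset (ℕ × ℕ)) (hφ : ∀ i ∈ t, φ i ∈ T) (x y : ℝ) :
    ∑ r ∈ T, (∑ i ∈ t, if r = φ i then c i else 0) * taylorMonomial r x y
      = ∑ i ∈ t, c i * taylorMonomial (φ i) x y := by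
  simp only [Finset.sum_mul]
  rw [Finset.sum_comm]
  refine Finset.sum_congr rfl fun i hi => ?_
  simp [Finset.sum_ite_eq', hφ i hi]

/-- The explicit sum in `GH` is the contribution of the indices outside the second sum, where the
forced jet is either zero or an alternating sign. Hence `GH` is the whole Taylor polynomial of the
jet forced by one unit datum. -/
lemma GH_eq_sum {M m n : ℕ} (hn : n ≤ 1) (hmn : m + n ≤ M + 1) (x y : ℝ) :
    GH S a z₀ M m n x y = ∑ r ∈ Lam (M + 1), AHu S a z₀ r.1 r.2 m n * taylorMonomial r x y := by
  have hsub : LamH2 (M + 1) \ LamH2 (m + n) ⊆ Lam (M + 1) := fun r hr => by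
    rw [Finset.mem_sdiff, mem_LamH2] at hr
    exact mem_Lam.mpr hr.1.1
  rw [← Finset.sum_sdiff hsub, GH]
  congr 1
  rw [Finset.sum_congr rfl (g := fun r => (∑ l ∈ Finset.range (m / 2 + 1),
    if r = (m - 2 * l, n + 2 * l) then (-1) ^ l else 0) * taylorMonomial r x y)]
  · rw [sum_ite_eq_taylorMonomial]
    · refine Finset.sum_congr rfl fun l _ => ?_
      rw [taylorMonomial]
      ring
    · intro l hl
      simp only [Finset.mem_sdiff, mem_LamH2, mem_Lam, Finset.mem_range] at hl ⊢
      omega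
  · intro r hr
    simp only [Finset.mem_sdiff, mem_LamH2, mem_Lam] at hr
    rw [AHu, coeffJet, forcedJet_single_u _ _ _ hn (by omega)]

lemma QH_eq_sum {M m n : ℕ} (hmn : m + n + 2 ≤ M + 1) (x y : ℝ) :
    QH S a z₀ M m n x y = ∑ r ∈ Lam (M + 1), AHf S a z₀ r.1 r.2 m n * taylorMonomial r x y := by
  have hsub : LamH2 (M + 1) \ LamH2 (m + n + 2) ⊆ Lam (M + 1) := fun r hr => by
    rw [Finset.mem_sdiff, mem_LamH2] at hr
    exact mem_Lam.mpr hr.1.1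
  rw [← Finset.sum_sdiff hsub, QH]
  congr 1
  rw [Finset.sum_congr rfl (g := fun r => (∑ l ∈ Finset.range (m / 2 + 1),
    if r = (m - 2 * l, n + 2 * l + 2) then (-1) ^ (l + 1) * (1 / a z₀) else 0)
      * taylorMonomial r x y)]
  · rw [sum_ite_eq_taylorMonomial]
    · rw [← Finset.Ico_add_one_right_eq_Icc, Finset.sum_Ico_eq_sum_range,
        show 1 + m / 2 + 1 - 1 = m / 2 + 1 by omega]
      refine Finset.sum_congr rfl fun l _ => ?_
      rw [taylorMonomial, show m + 2 - 2 * (1 + l) = m - 2 * l by omega,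
        show n + 2 * (1 + l) = n + 2 * l + 2 by omega, add_comm 1 l]
      ring
    · intro l hl
      simp only [Finset.mem_sdiff, mem_LamH2, mem_Lam, Finset.mem_range] at hl ⊢
      omega
  · intro r hr
    simp only [Finset.mem_sdiff, mem_LamH2, mem_Lam] at hr
    rw [AHf, coeffJet, forcedJet_single_f _ _ _ (by omega)]
    rfl

end Polynomials

/-! ### Jets of exact solutions -/

section EquationJets

variable {S : Set (ℝ × ℝ)} {a u f : ℝ × ℝ → ℝ}

/-- The equation `-∇ · (a ∇u) = f`, solved for `u_yy`. -/
lemma partialY_partialY_of_pde (hS : UniqueDiffOn ℝ S) (ha : ContDiffOn ℝ (1 : ℕ) a S)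
    (ha_pos : ∀ z ∈ S, 0 < a z) (hu : ContDiffOn ℝ (2 : ℕ) u S)
    (h : EqOn (fun z => -(partialX S (fun w => a w * partialX S u w) z
      + partialY S (fun w => a w * partialY S u w) z)) f S) :
    EqOn (partialY S (partialY S u)) (fun z => (-1) * partialX S (partialX S u) z
      + (-1) * (1 * (1 * (partialX S a z / a z * partialX S u z)
        + 1 * (partialY S a z / a z * partialY S u z)) + 1 * (1 / a z * f z))) S := by
  intro z hz
  have h1 := dirD_mul (e := (1, 0)) (n := 0) hS ha (contDiffOn_partialX hS (n := 1) hu) hz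
  have h2 := dirD_mul (e := (0, 1)) (n := 0) hS ha (contDiffOn_partialY hS (n := 1) hu) hz
  simp only [← partialX_eq_dirD, ← partialY_eq_dirD] at h1 h2
  have h3 := h hz
  simp only [h1, h2] at h3
  have := ha_pos z hz
  simp only
  field_simp
  linarith

/-- The differentiated equation. -/
lemma partialD_of_pde (hS : UniqueDiffOn ℝ S) (hcl : S ⊆ closure (interior S)) {N : ℕ}
    (ha : ContDiffOn ℝ (N + 1 : ℕ) a S) (ha_pos : ∀ z ∈ S, 0 < a z)
    (hu : ContDiffOn ℝ (N + 2 : ℕ) u S) (hf : ContDiffOn ℝ N f S)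
    (h : EqOn (fun z => -(partialX S (fun w => a w * partialX S u w) z
      + partialY S (fun w => a w * partialY S u w) z)) f S) {z : ℝ × ℝ} (hz : z ∈ S) {m n : ℕ}
    (hmn : m + n ≤ N) :
    partialD S m (n + 2) u z = -partialD S (m + 2) n u z
        - ∑ i ∈ Finset.range (m + 1), ∑ j ∈ Finset.range (n + 1),
            (m.choose i : ℝ) * (n.choose j : ℝ) *
              (partialD S i j (fun z => partialX S a z / a z) z
                  * partialD S (m - i + 1) (n - j) u z
                + partialD S i j (fun z => partialY S a z / a z) z
                  * partialD S (m - i) (n - j + 1) u z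
                + partialD S i j (fun z => 1 / a z) z * partialD S (m - i) (n - j) f z) := by
  have low : ∀ {v : ℝ × ℝ → ℝ} {k l : ℕ}, ContDiffOn ℝ k v S → l ≤ k → ContDiffOn ℝ l v S :=
    fun hv hl => hv.of_le (by exact_mod_cast hl)
  have ha0 : ∀ z ∈ S, a z ≠ 0 := fun z hz => (ha_pos z hz).ne'
  have haN : ContDiffOn ℝ (m + n : ℕ) a S := low ha (by omega)
  have hp : ContDiffOn ℝ (m + n : ℕ) (fun z => partialX S a z / a z) S :=
    (low (contDiffOn_partialX hS ha) hmn).div haN ha0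
  have hq : ContDiffOn ℝ (m + n : ℕ) (fun z => partialY S a z / a z) S :=
    (low (contDiffOn_partialY hS ha) hmn).div haN ha0
  have hs : ContDiffOn ℝ (m + n : ℕ) (fun z => 1 / a z) S :=
    contDiffOn_const.div haN ha0
  have hX : ContDiffOn ℝ (m + n + 1 : ℕ) (partialX S u) S :=
    contDiffOn_partialX hS (low hu (by omega))
  have hY : ContDiffOn ℝ (m + n + 1 : ℕ) (partialY S u) S :=
    contDiffOn_partialY hS (low hu (by omega))
  have hXX : ContDiffOn ℝ (m + n : ℕ) (partialX S (partialX S u)) S := contDiffOn_partialX hS hX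
  have hX' : ContDiffOn ℝ (m + n : ℕ) (partialX S u) S := low hX (by omega)
  have hY' : ContDiffOn ℝ (m + n : ℕ) (partialY S u) S := low hY (by omega)
  have hf' : ContDiffOn ℝ (m + n : ℕ) f S := low hf hmn
  have hpX := hp.mul hX'
  have hqY := hq.mul hY'
  have hsf := hs.mul hf'
  have hpq : ContDiffOn ℝ (m + n : ℕ) (fun z => 1 * (partialX S a z / a z * partialX S u z)
        + 1 * (partialY S a z / a z * partialY S u z)) S :=
    (contDiffOn_const.mul hpX).add (contDiffOn_const.mul hqY)
  have hT : ContDiffOn ℝ (m + n : ℕ) (fun z => 1 * (1 * (partialX S a z / a z * partialX S u z)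
        + 1 * (partialY S a z / a z * partialY S u z)) + 1 * (1 / a z * f z)) S :=
    (contDiffOn_const.mul hpq).add (contDiffOn_const.mul hsf)
  -- The factors `1` and `-1` in this form of the equation present it as nested binary linear
  -- combinations, to which `partialD_linear` applies three times.
  have hE := partialY_partialY_of_pde hS (low ha (by omega)) ha_pos (low hu (by omega)) h
  rw [partialD_succ_right, partialD_succ_right, partialD_congr m n hE hz,
    partialD_linear hS m n hXX hT _ _ hz]
  simp only
  rw [partialD_linear hS m n hpq hsf _ _ hz]
  simp only
  rw [partialD_linear hS m n hpX hqY _ _ hz]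
  simp only
  rw [partialD_mul hS m n hp hX' hz, partialD_mul hS m n hq hY' hz, partialD_mul hS m n hs hf' hz,
    partialD_partialX hS hcl m n hX hz]
  rw [partialD_partialX hS hcl (m + 1) n (low hu (by omega)) hz]
  simp only [one_mul, neg_one_mul, ← sub_eq_add_neg, ← Finset.sum_add_distrib]
  congr 1
  refine Finset.sum_congr rfl fun i hi => Finset.sum_congr rfl fun j hj => ?_
  rw [Finset.mem_range] at hi hj
  rw [partialD_partialX hS hcl (m - i) (n - j) (low hu (by omega)) hz, ← partialD_succ_right]
  ring

/-- The jet of a solution is forced by its tangential data and the source. -/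
lemma partialD_eq_coeffJet (hS : UniqueDiffOn ℝ S) (hcl : S ⊆ closure (interior S)) {N : ℕ}
    (ha : ContDiffOn ℝ (N + 1 : ℕ) a S) (ha_pos : ∀ z ∈ S, 0 < a z)
    (hu : ContDiffOn ℝ (N + 2 : ℕ) u S) (hf : ContDiffOn ℝ N f S)
    (h : EqOn (fun z => -(partialX S (fun w => a w * partialX S u w) z
      + partialY S (fun w => a w * partialY S u w) z)) f S) {z : ℝ × ℝ} (hz : z ∈ S) {m n : ℕ}
    (hmn : m + n ≤ N + 2) :
    partialD S m n u z = coeffJet S a z (fun r => partialD S r.1 r.2 u z)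
      (fun r => partialD S r.1 r.2 f z) m n := by
  rw [coeffJet]
  refine eq_forcedJet_of_recursion (K := N) (J := fun m n => partialD S m n u z) (fun m _ => ?_)
    (fun m _ => ?_) (fun m n hmn => ?_) m n hmn
  · rfl
  · rfl
  · exact partialD_of_pde hS hcl ha ha_pos hu hf h hz hmn

/-- If the jet of `u` is forced by its tangential data and a vanishing source, then the jet of the
source vanishes. -/
lemma source_jet_eq_zero (hS : UniqueDiffOn ℝ S) (hcl : S ⊆ closure (interior S)) {N : ℕ}
    (ha : ContDiffOn ℝ (N + 1 : ℕ) a S) (ha_pos : ∀ z ∈ S, 0 < a z)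
    (hu : ContDiffOn ℝ (N + 2 : ℕ) u S) (hf : ContDiffOn ℝ N f S)
    (h : EqOn (fun z => -(partialX S (fun w => a w * partialX S u w) z
      + partialY S (fun w => a w * partialY S u w) z)) f S) {z : ℝ × ℝ} (hz : z ∈ S)
    {d : ℕ × ℕ → ℝ} (hd : ∀ m n, m + n ≤ N + 2 → partialD S m n u z = coeffJet S a z d 0 m n)
    {m n : ℕ} (hmn : m + n ≤ N) : partialD S m n f z = 0 := by
  induction hk : m + n using Nat.strong_induction_on generalizing m n with
  | _ k ih =>
    have h1 := partialD_of_pde hS hcl ha ha_pos hu hf h hz hmn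
    rw [hd m (n + 2) (by omega), hd (m + 2) n (by omega), coeffJet, coeffJet, forcedJet_add_two,
      sub_right_inj] at h1
    have h2 : ∑ i ∈ Finset.range (m + 1), ∑ j ∈ Finset.range (n + 1),
        (m.choose i : ℝ) * (n.choose j : ℝ) *
          (partialD S i j (fun z => 1 / a z) z * partialD S (m - i) (n - j) f z) = 0 := by
      rw [← sub_eq_zero.mpr h1.symm]
      simp only [← Finset.sum_sub_distrib]
      refine Finset.sum_congr rfl fun i hi => Finset.sum_congr rfl fun j hj => ?_
      rw [Finset.mem_range] at hi hj
      rw [hd _ _ (by omega), hd _ _ (by omega), coeffJet, coeffJet, Pi.zero_apply]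
      ring
    -- By induction all lower derivatives of the source vanish; the remaining term is `f^{(m,n)} /
    -- a`.
    rw [Finset.sum_eq_single 0, Finset.sum_eq_single 0] at h2
    · have := (ha_pos z hz).ne'
      simpa [partialD_zero_zero, this] using h2
    · intro j hj hj0
      rw [Finset.mem_range] at hj
      rw [ih (m - 0 + (n - j)) (by omega) (by omega) rfl]
      ring
    · simp
    · intro i hi hi0
      rw [Finset.mem_range] at hi
      refine Finset.sum_eq_zero fun j hj => ?_
      rw [Finset.mem_range] at hj
      rw [ih (m - i + (n - j)) (by omega) (by omega) rfl]
      ring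
    · simp

end EquationJets

/-! ### Topology of the region, and the equation and Neumann data on the bottom side -/

namespace InterfaceDomain

variable (D : InterfaceDomain)

lemma isOpen_Ω : IsOpen D.Ω := isOpen_Ioo.prod isOpen_Ioo

lemma closure_Ω : closure D.Ω = Icc D.l₁ D.l₂ ×ˢ Icc D.l₃ D.l₄ := by
  rw [Ω, closure_prod_eq, closure_Ioo D.lt₁₂.ne, closure_Ioo D.lt₃₄.ne]

lemma Ω_subset_rectangle : D.Ω ⊆ Icc D.l₁ D.l₂ ×ˢ Icc D.l₃ D.l₄ :=
  Set.prod_mono Ioo_subset_Icc_self Ioo_subset_Icc_self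

lemma closure_interface_inter_Ω : closure D.interface ∩ D.Ω ⊆ D.interface := by
  rintro z ⟨hz, hΩ⟩
  refine ⟨hΩ, ?_⟩
  have : closure D.interface ⊆ {z | D.ψ z = 0} :=
    closure_minimal (fun z hz => hz.2) (isClosed_eq D.smooth_ψ.continuous continuous_const)
  exact this hz

lemma Ω_diff_interface_subset : D.Ω \ D.interface ⊆ D.region := fun _ hz =>
  ⟨D.Ω_subset_rectangle hz.1, fun h => hz.2 (D.closure_interface_inter_Ω ⟨h, hz.1⟩)⟩

lemma isOpen_Ω_diff_interface : IsOpen (D.Ω \ D.interface) := by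
  have : D.Ω \ D.interface = D.Ω \ closure D.interface := by
    ext z
    exact ⟨fun h => ⟨h.1, (D.Ω_diff_interface_subset h).2⟩,
      fun h => ⟨h.1, fun h' => h.2 (subset_closure h')⟩⟩
  rw [this]
  exact D.isOpen_Ω.sdiff isClosed_closure

/-- The removed set is closed, so each point of the region has a neighbourhood free of the
interface, and the open rectangle is dense in the closed one. -/
lemma region_subset_closure : D.region ⊆ closure (D.Ω \ D.interface) := by
  rintro z ⟨hz, hz'⟩
  rw [← closure_Ω] at hz
  have h1 : z ∈ closure ((closure D.interface)ᶜ ∩ D.Ω) :=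
    (isClosed_closure (s := D.interface)).isOpen_compl.inter_closure (Set.mem_inter hz' hz)
  have h2 : (closure D.interface)ᶜ ∩ D.Ω ⊆ D.Ω \ D.interface := fun w hw =>
    ⟨hw.2, fun h => hw.1 (subset_closure h)⟩
  exact closure_mono h2 h1

lemma Ω_diff_interface_subset_interior : D.Ω \ D.interface ⊆ interior D.region :=
  interior_maximal D.Ω_diff_interface_subset D.isOpen_Ω_diff_interface

lemma region_subset_closure_interior : D.region ⊆ closure (interior D.region) :=
  D.region_subset_closure.trans (closure_mono D.Ω_diff_interface_subset_interior)

lemma uniqueDiffOn_region : UniqueDiffOn ℝ D.region :=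
  ((uniqueDiffOn_Icc D.lt₁₂).prod (uniqueDiffOn_Icc D.lt₃₄)).inter isClosed_closure.isOpen_compl

lemma Ωpos_subset : D.Ωpos ⊆ D.Ω \ D.interface := fun _ hz => ⟨hz.1, fun h => hz.2.ne' h.2⟩

lemma Ωneg_subset : D.Ωneg ⊆ D.Ω \ D.interface := fun _ hz => ⟨hz.1, fun h => hz.2.ne h.2⟩

variable {D}

lemma PiecewiseSmooth.contDiffOn_nat {k : ℕ∞} {v : ℝ × ℝ → ℝ} (h : D.PiecewiseSmooth k v) {n : ℕ}
    (hn : (n : ℕ∞) ≤ k) : ContDiffOn ℝ n v D.region :=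
  h.contDiffOn.of_le (by exact_mod_cast hn)

lemma mem_region_bottom {x : ℝ} (hx : x ∈ Ioo D.l₁ D.l₂) (h : (x, D.l₃) ∉ closure D.interface) :
    (x, D.l₃) ∈ D.region :=
  ⟨⟨Ioo_subset_Icc_self hx, left_mem_Icc.mpr D.lt₃₄.le⟩, h⟩

/-- The equation holds up to the outer boundary. -/
lemma IsSolution.pde_region {k : ℕ∞} {a u f : ℝ × ℝ → ℝ} {g : ℝ → ℝ}
    (h : D.IsSolution k a u f g) (ha : ContDiffOn ℝ (1 : ℕ) a D.region) :
    EqOn (fun z => -(partialX D.region (fun w => a w * partialX D.region u w) z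
      + partialY D.region (fun w => a w * partialY D.region u w) z)) f D.region := by
  have hS := D.uniqueDiffOn_region
  have hu : ContDiffOn ℝ (2 : ℕ) u D.region := h.smooth_u.contDiffOn_nat le_add_self
  have hX : ContDiffOn ℝ (0 : ℕ) (partialX D.region fun w => a w * partialX D.region u w)
      D.region := contDiffOn_partialX hS (ha.mul (contDiffOn_partialX hS (n := 1) hu))
  have hY : ContDiffOn ℝ (0 : ℕ) (partialY D.region fun w => a w * partialY D.region u w)
      D.region := contDiffOn_partialY hS (ha.mul (contDiffOn_partialY hS (n := 1) hu))
  -- Both sides are continuous on the region, and they agree on a dense subset.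
  exact Set.EqOn.of_subset_closure (fun z hz => h.pde z hz)
    (hX.continuousOn.add hY.continuousOn).neg h.smooth_f.continuousOn D.Ω_diff_interface_subset
    D.region_subset_closure

/-- Tangential derivatives of the Neumann data. -/
lemma IsSolution.iteratedDeriv_neumann {k : ℕ∞} {a u f : ℝ × ℝ → ℝ} {g : ℝ → ℝ}
    (h : D.IsSolution k a u f g) {m : ℕ} (hm : (m : ℕ∞) ≤ k) {x : ℝ} (hx : x ∈ Ioo D.l₁ D.l₂)
    (hreg : (x, D.l₃) ∉ closure D.interface) :
    iteratedDeriv m g x = -partialD D.region m 1 u (x, D.l₃) := by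
  have hS := D.uniqueDiffOn_region
  induction m generalizing x with
  | zero =>
    rw [iteratedDeriv_zero, ← h.neumann x hx hreg, partialD, Function.iterate_zero, id,
      Function.iterate_one, partialY, ← map_neg]
    simp
  | succ m ih =>
    -- The induction hypothesis can be differentiated because it holds for all nearby `x`; the
    -- horizontal path through the point stays in the region there, so the chain rule applies to
    -- derivatives within the region.
    have hopen : IsOpen (Ioo D.l₁ D.l₂ ∩ {x | (x, D.l₃) ∉ closure D.interface}) :=
      isOpen_Ioo.inter (isClosed_closure.isOpen_compl.preimage (by fun_prop))
    have hnhds := hopen.mem_nhds ⟨hx, hreg⟩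
    have hu : ContDiffOn ℝ (1 + m + 1 : ℕ) u D.region := h.smooth_u.contDiffOn_nat (by
      rw [show 1 + m + 1 = (m + 1) + 1 by omega, Nat.cast_add]
      exact add_le_add hm (by norm_num))
    have hD := ((contDiffOn_partialD hS m 1 hu).differentiableOn (by simp))
      _ (mem_region_bottom hx hreg)
    have hc : HasDerivAt (fun x : ℝ => (x, D.l₃)) ((1 : ℝ), (0 : ℝ)) x :=
      (hasDerivAt_id x).prodMk (hasDerivAt_const x _)
    have hderiv := (hD.hasFDerivWithinAt.comp_hasDerivAt x hc (by
      filter_upwards [hnhds] with y hy using mem_region_bottom hy.1 hy.2)).neg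
    rw [iteratedDeriv_succ, partialD_succ_left]
    refine (hderiv.congr_of_eventuallyEq ?_).deriv
    filter_upwards [hnhds] with y hy
    rw [ih (le_trans (by exact_mod_cast Nat.le_succ m) hm) hy.1 hy.2]
    rfl

end InterfaceDomain

/-! ### Taylor polynomials -/

/-- The polynomial with the Taylor coefficients `J` at `z₀`. -/
def taylorPoly (z₀ : ℝ × ℝ) (M : ℕ) (J : ℕ → ℕ → ℝ) (z : ℝ × ℝ) : ℝ :=
  ∑ i ∈ Finset.range (M + 1), ∑ j ∈ Finset.range (M + 1),
    J i j * taylorMonomial (i, j) (z.1 - z₀.1) (z.2 - z₀.2)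

lemma contDiff_taylorPoly (z₀ : ℝ × ℝ) (M : ℕ) (J : ℕ → ℕ → ℝ) {n : WithTop ℕ∞} :
    ContDiff ℝ n (taylorPoly z₀ M J) := by
  unfold taylorPoly taylorMonomial
  fun_prop

/-- Differentiation shifts the coefficients; `hc` allows the shifted sum to keep the same range, so
that the step can be iterated. -/
lemma hasDerivAt_sum_pow_div_factorial {M : ℕ} {c : ℕ → ℝ} (hc : c (M + 1) = 0) (x₀ x : ℝ) :
    HasDerivAt (fun x => ∑ i ∈ Finset.range (M + 1), c i * ((x - x₀) ^ i / (i.factorial : ℝ)))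
      (∑ i ∈ Finset.range (M + 1), c (i + 1) * ((x - x₀) ^ i / (i.factorial : ℝ))) x := by
  have h : ∀ i ∈ Finset.range (M + 1),
      HasDerivAt (fun x => c i * ((x - x₀) ^ i / (i.factorial : ℝ)))
        (c i * ((i : ℝ) * (x - x₀) ^ (i - 1) / (i.factorial : ℝ))) x := fun i _ => by
    have := (((hasDerivAt_id x).sub_const x₀).pow i).div_const (i.factorial : ℝ) |>.const_mul (c i)
    simpa using this
  have h2 := HasDerivAt.fun_sum h
  refine h2.congr_deriv (Eq.symm ?_)
  rw [Finset.sum_range_succ, hc, Finset.sum_range_succ' (fun i => c i * ((i : ℝ) * (x - x₀) ^ (i - 1)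
    / (i.factorial : ℝ)))]
  simp only [zero_mul, add_zero, Nat.cast_zero, zero_div, mul_zero]
  refine Finset.sum_congr rfl fun i _ => ?_
  rw [Nat.factorial_succ]
  have : (i.factorial : ℝ) ≠ 0 := by positivity
  push_cast
  field_simp

lemma dirD_eq_of_hasDerivAt {S : Set (ℝ × ℝ)} (hS : UniqueDiffOn ℝ S) {v : ℝ × ℝ → ℝ}
    {z e : ℝ × ℝ} (hz : z ∈ S) (hv : DifferentiableAt ℝ v z) {c : ℝ → ℝ × ℝ} {t d : ℝ}
    (hct : c t = z) (hc : HasDerivAt c e t) (hd : HasDerivAt (fun x => v (c x)) d t) :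
    dirD S e v z = d := by
  rw [dirD, fderivWithin_eq_fderiv (hS z hz) hv]
  have h := hv.hasFDerivAt
  rw [← hct] at h
  have h2 := (h.comp_hasDerivAt t hc).unique hd
  rwa [hct] at h2

lemma partialX_taylorPoly {S : Set (ℝ × ℝ)} (hS : UniqueDiffOn ℝ S) (z₀ : ℝ × ℝ) {M : ℕ}
    {J : ℕ → ℕ → ℝ} (hJ : ∀ i j, M < i + j → J i j = 0) :
    EqOn (partialX S (taylorPoly z₀ M J)) (taylorPoly z₀ M fun i j => J (i + 1) j) S := by
  intro z hz
  have h := hasDerivAt_sum_pow_div_factorial (M := M) (c := fun i => ∑ j ∈ Finset.range (M + 1),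
    J i j * ((z.2 - z₀.2) ^ j / (j.factorial : ℝ)))
    (Finset.sum_eq_zero fun j _ => by rw [hJ _ _ (by omega), zero_mul]) z₀.1 z.1
  refine dirD_eq_of_hasDerivAt hS hz ((contDiff_taylorPoly z₀ M J (n := 1)).differentiable
    (by norm_num) z) (c := fun x => (x, z.2)) (t := z.1) rfl
    ((hasDerivAt_id _).prodMk (hasDerivAt_const _ _)) ?_
  convert h using 1
  · ext x
    simp only [taylorPoly, taylorMonomial, Finset.sum_mul]
    refine Finset.sum_congr rfl fun i _ => Finset.sum_congr rfl fun j _ => ?_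
    ring
  · simp only [taylorPoly, taylorMonomial, Finset.sum_mul]
    refine Finset.sum_congr rfl fun i _ => Finset.sum_congr rfl fun j _ => ?_
    ring

lemma partialY_taylorPoly {S : Set (ℝ × ℝ)} (hS : UniqueDiffOn ℝ S) (z₀ : ℝ × ℝ) {M : ℕ}
    {J : ℕ → ℕ → ℝ} (hJ : ∀ i j, M < i + j → J i j = 0) :
    EqOn (partialY S (taylorPoly z₀ M J)) (taylorPoly z₀ M fun i j => J i (j + 1)) S := by
  intro z hz
  have h := hasDerivAt_sum_pow_div_factorial (M := M) (c := fun j => ∑ i ∈ Finset.range (M + 1),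
    J i j * ((z.1 - z₀.1) ^ i / (i.factorial : ℝ)))
    (Finset.sum_eq_zero fun j _ => by rw [hJ _ _ (by omega), zero_mul]) z₀.2 z.2
  refine dirD_eq_of_hasDerivAt hS hz ((contDiff_taylorPoly z₀ M J (n := 1)).differentiable
    (by norm_num) z) (c := fun x => (z.1, x)) (t := z.2) rfl
    ((hasDerivAt_const _ _).prodMk (hasDerivAt_id _)) ?_
  convert h using 1
  · ext x
    simp only [taylorPoly, taylorMonomial, Finset.sum_mul]
    rw [Finset.sum_comm]
    refine Finset.sum_congr rfl fun i _ => Finset.sum_congr rfl fun j _ => ?_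
    ring
  · simp only [taylorPoly, taylorMonomial, Finset.sum_mul]
    rw [Finset.sum_comm]
    refine Finset.sum_congr rfl fun i _ => Finset.sum_congr rfl fun j _ => ?_
    ring

lemma partialD_taylorPoly {S : Set (ℝ × ℝ)} (hS : UniqueDiffOn ℝ S) (z₀ : ℝ × ℝ) {M : ℕ}
    {J : ℕ → ℕ → ℝ} (hJ : ∀ i j, M < i + j → J i j = 0) (m n : ℕ) :
    EqOn (partialD S m n (taylorPoly z₀ M J)) (taylorPoly z₀ M fun i j => J (i + m) (j + n)) S := by
  have hY : EqOn (partialD S 0 n (taylorPoly z₀ M J)) (taylorPoly z₀ M fun i j => J i (j + n)) S := by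
    induction n generalizing J with
    | zero => exact fun z _ => rfl
    | succ n ih =>
      rw [partialD_succ_right]
      refine (partialD_congr 0 n (partialY_taylorPoly hS z₀ hJ)).trans ?_
      simpa only [add_assoc, add_comm 1] using
        ih (J := fun i j => J i (j + 1)) (fun i j h => hJ _ _ (by omega))
  induction m with
  | zero => exact hY
  | succ m ih =>
    rw [partialD_succ_left]
    refine (dirD_congr ih).trans ((partialX_taylorPoly hS z₀ fun i j h => hJ _ _ (by omega)).trans ?_)
    intro z _
    simp only [add_assoc, add_comm 1]

lemma taylorPoly_self (z₀ : ℝ × ℝ) (M : ℕ) (J : ℕ → ℕ → ℝ) : taylorPoly z₀ M J z₀ = J 0 0 := by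
  rw [taylorPoly, Finset.sum_eq_single 0, Finset.sum_eq_single 0]
  · simp [taylorMonomial]
  · intro j _ hj
    simp [taylorMonomial, hj]
  · simp
  · intro i _ hi
    simp [taylorMonomial, hi]
  · simp

lemma partialD_taylorPoly_self {S : Set (ℝ × ℝ)} (hS : UniqueDiffOn ℝ S) {z₀ : ℝ × ℝ} (hz : z₀ ∈ S)
    {M : ℕ} {J : ℕ → ℕ → ℝ} (hJ : ∀ i j, M < i + j → J i j = 0) (m n : ℕ) :
    partialD S m n (taylorPoly z₀ M J) z₀ = J m n := by
  rw [partialD_taylorPoly hS z₀ hJ m n hz, taylorPoly_self, zero_add, zero_add]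

lemma taylorPoly_eq_sum_Lam (z₀ : ℝ × ℝ) {M : ℕ} {J : ℕ → ℕ → ℝ}
    (hJ : ∀ i j, M < i + j → J i j = 0) (x y : ℝ) :
    taylorPoly z₀ M J (z₀.1 + x, z₀.2 + y) = ∑ r ∈ Lam M, J r.1 r.2 * taylorMonomial r x y := by
  rw [taylorPoly, ← Finset.sum_product', Lam, Finset.sum_filter]
  refine Finset.sum_congr rfl fun r _ => ?_
  split_ifs with h
  · simp
  · rw [hJ _ _ (by omega), zero_mul]

/-- A function with vanishing jet vanishes to the corresponding order along segments. -/
lemma isBigO_of_partialD_eq_zero {S : Set (ℝ × ℝ)} (hS : UniqueDiffOn ℝ S)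
    (hcl : S ⊆ closure (interior S)) {z₀ e : ℝ × ℝ} (hz : z₀ ∈ S)
    (hseg : ∀ᶠ t in 𝓝[≥] (0 : ℝ), (z₀.1 + e.1 * t, z₀.2 + e.2 * t) ∈ S) (n : ℕ) {w : ℝ × ℝ → ℝ}
    (hw : ContDiffOn ℝ n w S) (hjet : ∀ i j, i + j < n → partialD S i j w z₀ = 0) :
    (fun t : ℝ => w (z₀.1 + e.1 * t, z₀.2 + e.2 * t)) =O[𝓝[≥] 0] fun t => t ^ n := by
  set c : ℝ → ℝ × ℝ := fun t => (z₀.1 + e.1 * t, z₀.2 + e.2 * t) with hcdef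
  have hc0 : c 0 = z₀ := by simp [c]
  have hcd : ∀ t, HasDerivAt c e t := fun t => by
    have h1 := ((hasDerivAt_id t).const_mul e.1).const_add z₀.1
    have h2 := ((hasDerivAt_id t).const_mul e.2).const_add z₀.2
    simpa using h1.prodMk h2
  induction n generalizing w with
  | zero =>
    simp only [pow_zero]
    have h1 : Tendsto c (𝓝[≥] 0) (𝓝[S] z₀) := by
      refine tendsto_nhdsWithin_iff.mpr ⟨?_, hseg⟩
      rw [← hc0]
      exact (hcd 0).continuousAt.tendsto.mono_left nhdsWithin_le_nhds
    exact ((hw.continuousOn z₀ hz).tendsto.comp h1).isBigO_one ℝ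
  | succ n ih =>
    -- Both first partial derivatives have a jet vanishing to one order less, and the derivative of
    -- `w` along the segment is their combination; the mean value inequality gains one power of `t`.
    have hX := ih (contDiffOn_partialX hS hw) fun i j hij => by
      rw [partialD_partialX hS hcl i j (hw.of_le (by norm_cast; omega)) hz]
      exact hjet _ _ (by omega)
    have hY := ih (contDiffOn_partialY hS hw) fun i j hij => by
      rw [← partialD_succ_right]
      exact hjet _ _ (by omega)
    obtain ⟨C, hC⟩ := ((hX.const_mul_left e.1).add (hY.const_mul_left e.2)).bound
    obtain ⟨δ, hδ, hsub⟩ := (mem_nhdsGE_iff_exists_Icc_subset).mp (hC.and hseg)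
    have hw0 : w (c 0) = 0 := by
      rw [hc0]
      exact hjet 0 0 (by omega)
    refine IsBigO.of_bound C ?_
    filter_upwards [Icc_mem_nhdsGE hδ] with t ht
    have hmv := Convex.norm_image_sub_le_of_norm_hasDerivWithin_le (f := fun t => w (c t))
      (f' := fun t => e.1 * partialX S w (c t) + e.2 * partialY S w (c t)) (s := Icc 0 t)
      (C := C * t ^ n) (x := 0) (y := t) ?_ ?_ (convex_Icc 0 t) (left_mem_Icc.mpr ht.1)
      (right_mem_Icc.mpr ht.1)
    · simp only [hw0, sub_zero] at hmv
      refine hmv.trans (le_of_eq ?_)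
      rw [pow_succ, norm_mul, norm_pow, Real.norm_of_nonneg ht.1]
      ring
    · intro r hr
      have hrS : c r ∈ S := (hsub ⟨hr.1, hr.2.trans ht.2⟩).2
      have hd := (hw.diffAt_of_succ hrS).hasFDerivWithinAt.comp_hasDerivWithinAt r
        (hcd r).hasDerivWithinAt (s := Icc 0 t) fun r' hr' => (hsub ⟨hr'.1, hr'.2.trans ht.2⟩).2
      have he : e = e.1 • ((1 : ℝ), (0 : ℝ)) + e.2 • ((0 : ℝ), (1 : ℝ)) := by
        ext <;> simp
      have hval : fderivWithin ℝ w S (c r) e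
          = e.1 * partialX S w (c r) + e.2 * partialY S w (c r) := by
        conv_lhs => rw [he]
        rw [map_add, map_smul, map_smul]
        rfl
      rw [hval] at hd
      exact hd
    · intro r hr
      have h1 := (hsub ⟨hr.1, hr.2.trans ht.2⟩).1
      have hC0 : 0 ≤ C * r ^ n := by
        have := (norm_nonneg _).trans h1
        rwa [norm_pow, Real.norm_of_nonneg hr.1] at this
      refine h1.trans ?_
      rw [norm_pow, Real.norm_of_nonneg hr.1]
      -- The constant `C` is not known to be nonnegative. If `r ^ n = 0`, the bound at `t` itself
      -- gives `0 ≤ C * t ^ n`; otherwise the bound at `r` gives `0 ≤ C`.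
      rcases eq_or_lt_of_le (pow_nonneg hr.1 n) with h0 | h0
      · rw [← h0, mul_zero]
        rcases eq_or_lt_of_le hr.1 with h | h
        · have hn : n ≠ 0 := by
            rintro rfl
            simp at h0
          by_contra! hneg
          have h2 := (hsub ⟨le_rfl, hδ.le⟩).1
          have h3 := (hsub ⟨ht.1, ht.2⟩).1
          have h4 := (norm_nonneg _).trans h3
          rw [norm_pow, Real.norm_of_nonneg ht.1] at h4
          linarith
        · exact absurd h0 (pow_pos h n).ne
      · have : 0 ≤ C := by
          by_contra! hneg
          nlinarith
        gcongr
        · exact hr.1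
        · exact hr.2

/-- Taylor expansion along segments. -/
lemma sub_taylor_isBigO {S : Set (ℝ × ℝ)} (hS : UniqueDiffOn ℝ S)
    (hcl : S ⊆ closure (interior S)) {z₀ e : ℝ × ℝ} (hz : z₀ ∈ S)
    (hseg : ∀ᶠ t in 𝓝[≥] (0 : ℝ), (z₀.1 + e.1 * t, z₀.2 + e.2 * t) ∈ S) (K : ℕ) {u : ℝ × ℝ → ℝ}
    (hu : ContDiffOn ℝ (K + 1 : ℕ) u S) :
    (fun t : ℝ => u (z₀.1 + e.1 * t, z₀.2 + e.2 * t)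
      - ∑ r ∈ Lam K, partialD S r.1 r.2 u z₀ * taylorMonomial r (e.1 * t) (e.2 * t))
        =O[𝓝[>] 0] fun t => t ^ (K + 1) := by
  -- `taylorPoly` sums over a square of indices; cutting the jet off above order `K` leaves the
  -- triangle `Lam K`.
  set J : ℕ → ℕ → ℝ := fun i j => if i + j ≤ K then partialD S i j u z₀ else 0 with hJdef
  have hJ : ∀ i j, K < i + j → J i j = 0 := fun i j h => if_neg (by omega)
  have hP : ContDiffOn ℝ (K + 1 : ℕ) (taylorPoly z₀ K J) S := (contDiff_taylorPoly z₀ K J).contDiffOn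
  have h := isBigO_of_partialD_eq_zero hS hcl hz hseg (K + 1)
    (w := fun z => 1 * u z + (-1) * taylorPoly z₀ K J z)
    ((contDiffOn_const.mul hu).add (contDiffOn_const.mul hP)) fun i j hij => by
      rw [partialD_linear hS i j (hu.of_le (by exact_mod_cast hij.le))
        (hP.of_le (by exact_mod_cast hij.le)) _ _ hz]
      simp only
      rw [partialD_taylorPoly_self hS hz hJ]
      simp [J, Nat.lt_succ_iff.mp hij]
  refine (h.mono (nhdsWithin_mono 0 Ioi_subset_Ici_self)).congr_left fun t => ?_
  rw [taylorPoly_eq_sum_Lam z₀ hJ, one_mul, neg_one_mul, ← sub_eq_add_neg]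
  congr 1
  refine Finset.sum_congr rfl fun r hr => ?_
  simp [J, mem_Lam.mp hr]

/-! ### Order six of the schemes -/

lemma tendsto_stencilCoeff (c : Stencil → Fin 7 → ℝ) (s : Stencil) :
    Tendsto (stencilCoeff c s) (𝓝[>] 0) (𝓝 (c s 0)) := by
  have h : Continuous (stencilCoeff c s) := by
    unfold stencilCoeff
    fun_prop
  have h2 := h.tendsto 0
  have h3 : stencilCoeff c s 0 = c s 0 := by simp [stencilCoeff, Fin.sum_univ_succ]
  rw [h3] at h2
  exact h2.mono_left nhdsWithin_le_nhds

lemma sum_Lam_filter (K : ℕ) (φ : ℕ × ℕ → ℝ) :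
    ∑ r ∈ (Lam (K + 1)).filter (fun r => r.2 ≤ 1), φ r
      = ∑ n ∈ Finset.range (K + 2), φ (n, 0) + ∑ n ∈ Finset.range (K + 1), φ (n, 1) := by
  have h : (Lam (K + 1)).filter (fun r => r.2 ≤ 1)
      = (Finset.range (K + 2) ×ˢ {0}) ∪ (Finset.range (K + 1) ×ˢ {1}) := by
    ext r
    simp only [Finset.mem_filter, mem_Lam, Finset.mem_union, Finset.mem_product, Finset.mem_range,
      Finset.mem_singleton]
    omega
  rw [h, Finset.sum_union, Finset.sum_product, Finset.sum_product]
  · simp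
  · rw [Finset.disjoint_left]
    intro r
    simp only [Finset.mem_product, Finset.mem_singleton]
    omega

namespace InterfaceDomain

variable {D : InterfaceDomain}

lemma eventually_stencil_mem_region {x₀ : ℝ} (hx₀ : x₀ ∈ Ioo D.l₁ D.l₂)
    (hreg : (x₀, D.l₃) ∉ closure D.interface) (s : Stencil) :
    ∀ᶠ t in 𝓝[≥] (0 : ℝ), (x₀ + s.k * t, D.l₃ + s.l * t) ∈ D.region := by
  have hc : Continuous fun t : ℝ => (x₀ + s.k * t, D.l₃ + s.l * t) := by fun_prop
  have hopen : IsOpen ((Ioo D.l₁ D.l₂ ×ˢ Iio D.l₄) ∩ (closure D.interface)ᶜ) :=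
    (isOpen_Ioo.prod isOpen_Iio).inter isClosed_closure.isOpen_compl
  have h0 : (fun t : ℝ => (x₀ + s.k * t, D.l₃ + s.l * t)) 0
      ∈ (Ioo D.l₁ D.l₂ ×ˢ Iio D.l₄) ∩ (closure D.interface)ᶜ := by
    simpa using ⟨⟨hx₀, D.lt₃₄⟩, hreg⟩
  filter_upwards [nhdsWithin_le_nhds (hc.continuousAt.preimage_mem_nhds (hopen.mem_nhds h0)),
    self_mem_nhdsWithin] with t ht ht0
  refine ⟨⟨Ioo_subset_Icc_self ht.1.1, ?_, le_of_lt ht.1.2⟩, ht.2⟩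
  have : 0 ≤ s.l * t := mul_nonneg (Nat.cast_nonneg _) ht0
  simp only
  linarith

/-- Substitution of the forced jet into the Taylor polynomial. -/
lemma IsSolution.taylor_eq {a u f : ℝ × ℝ → ℝ} {g : ℝ → ℝ} (h : D.IsSolution 5 a u f g)
    (ha : D.PiecewiseSmooth 6 a) (ha_pos : ∀ z ∈ D.region, 0 < a z) {x₀ : ℝ}
    (hx₀ : x₀ ∈ Ioo D.l₁ D.l₂) (hreg : (x₀, D.l₃) ∉ closure D.interface) (x y : ℝ) :
    ∑ r ∈ Lam 6, partialD D.region r.1 r.2 u (x₀, D.l₃) * taylorMonomial r x y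
      = ∑ n ∈ Finset.range 7, partialD D.region n 0 u (x₀, D.l₃) * GH D.region a (x₀, D.l₃) 5 n 0 x y
        - ∑ n ∈ Finset.range 6, iteratedDeriv n g x₀ * GH D.region a (x₀, D.l₃) 5 n 1 x y
        + ∑ r ∈ Lam 4, partialD D.region r.1 r.2 f (x₀, D.l₃)
          * QH D.region a (x₀, D.l₃) 5 r.1 r.2 x y := by
  have hS := D.uniqueDiffOn_region
  have hz := mem_region_bottom hx₀ hreg
  have hjet : ∀ r ∈ Lam 6, partialD D.region r.1 r.2 u (x₀, D.l₃)
      = ∑ r' ∈ (Lam 6).filter (fun r => r.2 ≤ 1), partialD D.region r'.1 r'.2 u (x₀, D.l₃)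
          * AHu D.region a (x₀, D.l₃) r.1 r.2 r'.1 r'.2
        + ∑ r' ∈ Lam 4, partialD D.region r'.1 r'.2 f (x₀, D.l₃)
          * AHf D.region a (x₀, D.l₃) r.1 r.2 r'.1 r'.2 := by
    intro r hr
    rw [partialD_eq_coeffJet (N := 4) hS D.region_subset_closure_interior
      (ha.contDiffOn_nat (by norm_num)) ha_pos (h.smooth_u.contDiffOn_nat (by norm_num))
      (h.smooth_f.of_le (by norm_num)) (h.pde_region (ha.contDiffOn_nat (by norm_num))) hz
      (mem_Lam.mp hr), coeffJet, forcedJet_expand (K := 4) _ _ (mem_Lam.mp hr)]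
    rfl
  rw [Finset.sum_congr rfl fun r hr => by rw [hjet r hr, add_mul, Finset.sum_mul, Finset.sum_mul],
    Finset.sum_add_distrib, Finset.sum_comm, Finset.sum_comm (t := Lam 4)]
  have hu : ∀ r' ∈ (Lam 6).filter (fun r => r.2 ≤ 1),
      ∑ r ∈ Lam 6, partialD D.region r'.1 r'.2 u (x₀, D.l₃)
          * AHu D.region a (x₀, D.l₃) r.1 r.2 r'.1 r'.2 * taylorMonomial r x y
        = partialD D.region r'.1 r'.2 u (x₀, D.l₃)
          * GH D.region a (x₀, D.l₃) 5 r'.1 r'.2 x y := fun r' hr' => by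
    rw [Finset.mem_filter, mem_Lam] at hr'
    rw [GH_eq_sum _ _ _ hr'.2 hr'.1, Finset.mul_sum]
    exact Finset.sum_congr rfl fun r _ => mul_assoc _ _ _
  have hf : ∀ r' ∈ Lam 4, ∑ r ∈ Lam 6, partialD D.region r'.1 r'.2 f (x₀, D.l₃)
          * AHf D.region a (x₀, D.l₃) r.1 r.2 r'.1 r'.2 * taylorMonomial r x y
        = partialD D.region r'.1 r'.2 f (x₀, D.l₃)
          * QH D.region a (x₀, D.l₃) 5 r'.1 r'.2 x y := fun r' hr' => by
    rw [mem_Lam] at hr'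
    rw [QH_eq_sum _ _ _ (by omega), Finset.mul_sum]
    exact Finset.sum_congr rfl fun r _ => mul_assoc _ _ _
  rw [Finset.sum_congr rfl hu, Finset.sum_congr rfl hf, sum_Lam_filter, sub_eq_add_neg,
    ← Finset.sum_neg_distrib]
  congr 2
  refine Finset.sum_congr rfl fun n hn => ?_
  rw [Finset.mem_range] at hn
  rw [h.iteratedDeriv_neumann (by exact_mod_cast Nat.lt_succ_iff.mp hn) hx₀ hreg]
  ring

end InterfaceDomain

-- The `f` and `g` terms cancel identically. The residual consists of Taylor remainders times
-- bounded coefficients and of the numbers `u^{(n,0)}` times the sums controlled by the linear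
-- system.
open InterfaceDomain in
theorem neumannScheme_hasOrder_six {D : InterfaceDomain} {a : ℝ × ℝ → ℝ}
    (ha : D.PiecewiseSmooth 6 a) (ha_pos : ∀ z ∈ D.region, 0 < a z) {x₀ : ℝ}
    (hx₀ : x₀ ∈ Ioo D.l₁ D.l₂) (hreg : (x₀, D.l₃) ∉ closure D.interface)
    {c : Stencil → Fin 7 → ℝ} (hc : SolvesNeumannSystem D a x₀ c) :
    (neumannScheme D a x₀ c).HasOrder D a x₀ 5 4 5 6 := by
  intro u f g h
  have hres : ∀ t : ℝ, (neumannScheme D a x₀ c).residual D x₀ 4 5 u f g t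
      = ∑ s : Stencil, stencilCoeff c s t * (u (x₀ + s.k * t, D.l₃ + s.l * t)
          - ∑ r ∈ Lam 6, partialD D.region r.1 r.2 u (x₀, D.l₃)
            * taylorMonomial r (s.k * t) (s.l * t))
        + ∑ n ∈ Finset.range 7, partialD D.region n 0 u (x₀, D.l₃) * ∑ s : Stencil,
          stencilCoeff c s t * GH D.region a (x₀, D.l₃) 5 n 0 (s.k * t) (s.l * t) := by
    intro t
    simp only [h.taylor_eq ha ha_pos hx₀ hreg, SixPointScheme.residual, neumannScheme]
    have e1 : ∀ (ι : Type) (T : Finset ι) (A : ι → ℝ) (B : ι → Stencil → ℝ) (C : Stencil → ℝ),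
        ∑ i ∈ T, A i * ∑ s, C s * B i s = ∑ s, C s * ∑ i ∈ T, A i * B i s := by
      intro ι T A B C
      simp only [Finset.mul_sum]
      rw [Finset.sum_comm]
      exact Finset.sum_congr rfl fun s _ => Finset.sum_congr rfl fun i _ => by ring
    simp only [mul_neg, Finset.sum_neg_distrib, e1]
    simp only [← Finset.sum_add_distrib, ← Finset.sum_sub_distrib, ← Finset.sum_neg_distrib]
    exact Finset.sum_congr rfl fun s _ => by ring
  refine IsBigO.congr_left ?_ fun t => (hres t).symm
  refine IsBigO.add (IsBigO.fun_sum fun s _ => ?_) (IsBigO.fun_sum fun n hn => ?_)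
  · have h1 := sub_taylor_isBigO D.uniqueDiffOn_region D.region_subset_closure_interior
      (e := (s.k, s.l)) (mem_region_bottom hx₀ hreg) (eventually_stencil_mem_region hx₀ hreg s) 6
      (h.smooth_u.contDiffOn_nat (by norm_num))
    simpa using ((tendsto_stencilCoeff c s).isBigO_one ℝ).mul h1
  · rw [Finset.mem_range] at hn
    exact (hc n (by omega)).const_mul_left _

/-! ### Homogeneous parts on the stencil -/

/-- The homogeneous part of degree `j` of the polynomial with Taylor coefficients `J`, at a stencil
point. -/
def slice (J : ℕ → ℕ → ℝ) (j : ℕ) (s : Stencil) : ℝ :=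
  ∑ r ∈ Finset.HasAntidiagonal.antidiagonal j, J r.1 r.2 * taylorMonomial r s.k s.l

lemma slice_congr {J J' : ℕ → ℕ → ℝ} {j : ℕ} (h : ∀ m n, m + n = j → J m n = J' m n) (s : Stencil) :
    slice J j s = slice J' j s :=
  Finset.sum_congr rfl fun r hr => by rw [h _ _ (Finset.HasAntidiagonal.mem_antidiagonal.mp hr)]

lemma slice_eq_zero {J : ℕ → ℕ → ℝ} {j : ℕ} (h : ∀ m n, m + n = j → J m n = 0) (s : Stencil) :
    slice J j s = 0 :=
  Finset.sum_eq_zero fun r hr => by rw [h _ _ (Finset.HasAntidiagonal.mem_antidiagonal.mp hr), zero_mul]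

lemma sum_Lam_eq_sum_antidiagonal (M : ℕ) (φ : ℕ × ℕ → ℝ) :
    ∑ r ∈ Lam M, φ r = ∑ j ∈ Finset.range (M + 1), ∑ r ∈ Finset.HasAntidiagonal.antidiagonal j, φ r := by
  rw [← Finset.sum_fiberwise_of_maps_to (s := Lam M) (t := Finset.range (M + 1))
    (g := fun r => r.1 + r.2) fun r hr => by
      rw [Finset.mem_range, Nat.lt_succ_iff]; exact mem_Lam.mp hr]
  refine Finset.sum_congr rfl fun j hj => Finset.sum_congr ?_ fun _ _ => rfl
  rw [Finset.mem_range] at hj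
  ext r
  simp only [Finset.mem_filter, mem_Lam, Finset.HasAntidiagonal.mem_antidiagonal]
  omega

lemma sum_Lam_stencil (M : ℕ) (J : ℕ → ℕ → ℝ) (s : Stencil) (h : ℝ) :
    ∑ r ∈ Lam M, J r.1 r.2 * taylorMonomial r (s.k * h) (s.l * h)
      = ∑ j ∈ Finset.range (M + 1), h ^ j * slice J j s := by
  rw [sum_Lam_eq_sum_antidiagonal]
  refine Finset.sum_congr rfl fun j _ => ?_
  rw [slice, Finset.mul_sum]
  refine Finset.sum_congr rfl fun r hr => ?_
  rw [← Finset.HasAntidiagonal.mem_antidiagonal.mp hr, taylorMonomial, taylorMonomial, mul_pow, mul_pow, pow_add]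
  ring

/-- Taylor coefficients of `Re (x + iy)^n / n!`. -/
def harmonicCoeff : ℕ → ℝ
  | 0 => 1
  | 1 => 0
  | i + 2 => -harmonicCoeff i

/-- Taylor coefficients of the first correction to `Re (x + iy)^n / n!` for the equation
`u_yy = -u_xx - p u_x - q u_y`. -/
def correctionCoeff (p q : ℝ) : ℕ → ℝ
  | 0 => 0
  | 1 => 0
  | i + 2 => -correctionCoeff p q i - (p * harmonicCoeff i + q * harmonicCoeff (i + 1))

section

variable (p q s : ℕ → ℕ → ℝ)

/-- In the lowest order the equation reads `u_yy = -u_xx`, and the entry depends on `i` alone. -/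
lemma forcedJet_single_eq_harmonicCoeff {n m i : ℕ} (h : m + i = n) :
    forcedJet p q s (Pi.single (n, 0) 1) 0 i m = harmonicCoeff i := by
  induction i using Nat.strong_induction_on generalizing m with
  | _ i ih =>
    match i, ih, h with
    | 0, _, h => simp [forcedJet_zero, harmonicCoeff, ← h]
    | 1, _, h => simp [forcedJet_one, harmonicCoeff]
    | i + 2, ih, h =>
      rw [forcedJet_principal (K := n) (F := 0)
        (fun r _ hr => single_data_eq_zero (le_refl (n + 0)) r hr) (fun _ _ => rfl) (by omega), ih i (by omega) (by omega), harmonicCoeff]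
      simp

/-- One order higher, rows 0 and 1 are zero and the harmonic part enters as a source, multiplied by
the values of `p` and `q`; their derivatives would meet only entries of order below `n`. -/
lemma forcedJet_single_eq_correctionCoeff {n m i : ℕ} (h : m + i = n + 1) :
    forcedJet p q s (Pi.single (n, 0) 1) 0 i m = correctionCoeff (p 0 0) (q 0 0) i := by
  induction i using Nat.strong_induction_on generalizing m with
  | _ i ih =>
    match i, ih, h with
    | 0, _, h =>
      rw [forcedJet_zero, correctionCoeff, Pi.single_apply, if_neg]
      rw [Prod.mk.injEq]
      omega
    | 1, _, h => simp [forcedJet_one, correctionCoeff]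
    | i + 2, ih, h =>
      rw [forcedJet_subprincipal (K := n)
        (fun r _ hr => single_data_eq_zero (le_refl (n + 0)) r hr) (by omega),
        ih i (by omega) (by omega), forcedJet_single_eq_harmonicCoeff _ _ _ (by omega),
        forcedJet_single_eq_harmonicCoeff _ _ _ (by omega), correctionCoeff]

lemma forcedJet_single_eq_zero {n m i : ℕ} (h : m + i < n) :
    forcedJet p q s (Pi.single (n, 0) 1) 0 i m = 0 :=
  forcedJet_eq_zero_of_lt (fun r _ hr => single_data_eq_zero (le_refl (n + 0)) r hr)
    (fun _ _ => rfl) h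

end

/-- `Re (k + iℓ)^n / n!` at a stencil point. -/
def harmonicSlice (n : ℕ) (s : Stencil) : ℝ := slice (fun _ i => harmonicCoeff i) n s

/-- The first correction to `Re (k + iℓ)^n / n!`. -/
def correctionSlice (p q : ℝ) (n : ℕ) (s : Stencil) : ℝ :=
  slice (fun _ i => correctionCoeff p q i) (n + 1) s

/-- The coefficients of the compact stencil for the Laplace equation at a Neumann boundary. -/
def laplaceStencil (s : Stencil) : ℝ := ![![2, 1], ![-10, 4], ![2, 1]] s.1 s.2

lemma sum_stencil (φ : Stencil → ℝ) :
    ∑ s, φ s = φ (0, 0) + φ (0, 1) + (φ (1, 0) + φ (1, 1)) + (φ (2, 0) + φ (2, 1)) := by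
  simp [Fintype.sum_prod_type, Fin.sum_univ_succ, add_assoc]

lemma harmonicSlice_eq (s : Stencil) :
    harmonicSlice 0 s = 1 ∧ harmonicSlice 1 s = s.k ∧
    harmonicSlice 2 s = (s.k ^ 2 - s.l ^ 2) / 2 ∧
    harmonicSlice 3 s = (s.k ^ 3 - 3 * s.k * s.l ^ 2) / 6 ∧
    harmonicSlice 4 s = (s.k ^ 4 - 6 * s.k ^ 2 * s.l ^ 2 + s.l ^ 4) / 24 ∧
    harmonicSlice 5 s = (s.k ^ 5 - 10 * s.k ^ 3 * s.l ^ 2 + 5 * s.k * s.l ^ 4) / 120 ∧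
    harmonicSlice 6 s
      = (s.k ^ 6 - 15 * s.k ^ 4 * s.l ^ 2 + 15 * s.k ^ 2 * s.l ^ 4 - s.l ^ 6) / 720 := by
  simp only [harmonicSlice, slice, Finset.Nat.sum_antidiagonal_eq_sum_range_succ_mk,
    Finset.sum_range_succ, Finset.sum_range_zero, harmonicCoeff, taylorMonomial, Nat.factorial]
  norm_num [show harmonicCoeff 0 = 1 from rfl, show harmonicCoeff 1 = 0 from rfl]
  refine ⟨?_, ?_, ?_, ?_, ?_⟩ <;> ring

lemma correctionSlice_eq (p q : ℝ) (s : Stencil) :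
    correctionSlice p q 1 s = -p * s.l ^ 2 / 2 ∧
    correctionSlice p q 2 s = -p * (s.k * s.l ^ 2 / 2) + q * (s.l ^ 3 / 6) ∧
    correctionSlice p q 3 s = -p * (s.k ^ 2 * s.l ^ 2 / 4) + q * (s.k * s.l ^ 3 / 6)
      + 2 * p * (s.l ^ 4 / 24) ∧
    correctionSlice p q 5 s = -p * (s.k ^ 4 * s.l ^ 2 / 48) + q * (s.k ^ 3 * s.l ^ 3 / 36)
      + 2 * p * (s.k ^ 2 * s.l ^ 4 / 48) - 2 * q * (s.k * s.l ^ 5 / 120)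
      - 3 * p * (s.l ^ 6 / 720) ∧
    correctionSlice p q 6 s = -p * (s.k ^ 5 * s.l ^ 2 / 240) + q * (s.k ^ 4 * s.l ^ 3 / 144)
      + 2 * p * (s.k ^ 3 * s.l ^ 4 / 144) - 2 * q * (s.k ^ 2 * s.l ^ 5 / 240)
      - 3 * p * (s.k * s.l ^ 6 / 720) + 3 * q * (s.l ^ 7 / 5040) := by
  simp only [correctionSlice, slice, Finset.Nat.sum_antidiagonal_eq_sum_range_succ_mk,
    Finset.sum_range_succ, Finset.sum_range_zero, correctionCoeff, harmonicCoeff, taylorMonomial,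
    Nat.factorial]
  norm_num [show harmonicCoeff 0 = 1 from rfl, show harmonicCoeff 1 = 0 from rfl,
    show correctionCoeff p q 0 = 0 from rfl, show correctionCoeff p q 1 = 0 from rfl]
  refine ⟨?_, ?_, ?_, ?_, ?_⟩ <;> ring

/-- The stencil is the compact nine-point Laplacian with weights `-20, 4, 1`, folded along `ℓ = 0`
and halved; `Re z^n` is even in `y`. -/
lemma sum_laplaceStencil_harmonicSlice {n : ℕ} (hn : n ≤ 6) :
    ∑ s, laplaceStencil s * harmonicSlice n s = 0 := by
  rw [sum_stencil]
  interval_cases n <;> simp [harmonicSlice_eq, laplaceStencil, Stencil.k, Stencil.l] <;> norm_num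

/-- Linear relation between the harmonic polynomials of degrees 1, 3 and 5 on the stencil. -/
lemma harmonicSlice_relation (s : Stencil) :
    2 * harmonicSlice 1 s - 30 * harmonicSlice 3 s + 360 * harmonicSlice 5 s = 0 := by
  obtain ⟨i, j⟩ := s
  fin_cases i <;> fin_cases j <;> simp [harmonicSlice_eq, Stencil.k, Stencil.l] <;> norm_num

/-- The harmonic polynomials of degrees 2 and 6 agree on the stencil up to normalization. -/
lemma harmonicSlice_six (s : Stencil) : 720 * harmonicSlice 6 s - 2 * harmonicSlice 2 s = 0 := by
  obtain ⟨i, j⟩ := s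
  fin_cases i <;> fin_cases j <;> simp [harmonicSlice_eq, Stencil.k, Stencil.l] <;> norm_num

/-- This is the compatibility condition which makes level 1 solvable, in view of
`harmonicSlice_relation`. The `q` terms are odd in `k` and cancel by symmetry; the `p` terms cancel
numerically. -/
lemma sum_laplaceStencil_correctionSlice_odd (p q : ℝ) :
    ∑ s, laplaceStencil s * (2 * correctionSlice p q 1 s - 30 * correctionSlice p q 3 s
      + 360 * correctionSlice p q 5 s) = 0 := by
  rw [sum_stencil]
  simp [correctionSlice_eq, laplaceStencil, Stencil.k, Stencil.l]
  ring

/-- This is the obstruction to order seven: the combination of `harmonicSlice_six` fails at the next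
degree unless `q = 0`. -/
lemma sum_laplaceStencil_correctionSlice_even (p q : ℝ) :
    ∑ s, laplaceStencil s * (720 * correctionSlice p q 6 s - 2 * correctionSlice p q 2 s)
      = -10 * q / 7 := by
  rw [sum_stencil]
  simp [correctionSlice_eq, laplaceStencil, Stencil.k, Stencil.l]
  ring

/-- Moments with `n` even see only the part of `v` even in `k`, those with `n` odd only the odd
part. With the entry at `k = 0`, `ℓ = 1` set to zero, the moments 0, 2, 4 fix the even part and 1, 3
the odd part. -/
lemma exists_stencil_harmonicSlice_eq (b : ℕ → ℝ) :
    ∃ v : Stencil → ℝ, ∀ n ≤ 4, ∑ s, v s * harmonicSlice n s = b n := by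
  set δ := (2 * b 2 - 24 * b 4) / 8 with hδ
  set δ' := (b 1 - 6 * b 3) / 6 with hδ'
  set β' := b 1 / 2 - δ' with hβ'
  refine ⟨fun s => ![![b 2 - β', δ - δ'], ![b 0 - 2 * b 2 - 2 * δ, 0], ![b 2 + β', δ + δ']] s.1 s.2,
    fun n hn => ?_⟩
  rw [sum_stencil]
  interval_cases n <;> simp [harmonicSlice_eq, Stencil.k, Stencil.l] <;>
    simp only [hβ', hδ, hδ'] <;> ring

/-- A stencil vector with trivial harmonic moments up to degree five is a multiple of the Laplace
stencil. -/
lemma eq_smul_laplaceStencil {v : Stencil → ℝ} (h : ∀ n ≤ 5, ∑ s, v s * harmonicSlice n s = 0) :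
    ∃ c : ℝ, v = fun s => c * laplaceStencil s := by
  -- The Laplace stencil has the entry 1 at `k = -1`, `ℓ = 1`. The moments up to degree four already
  -- suffice: five independent conditions on six entries.
  refine ⟨v (0, 1), ?_⟩
  have h0 := h 0 (by norm_num)
  have h1 := h 1 (by norm_num)
  have h2 := h 2 (by norm_num)
  have h3 := h 3 (by norm_num)
  have h4 := h 4 (by norm_num)
  rw [sum_stencil] at h0 h1 h2 h3 h4
  simp [harmonicSlice_eq, Stencil.k, Stencil.l] at h0 h1 h2 h3 h4
  ext ⟨i, j⟩
  fin_cases i <;> fin_cases j <;> simp [laplaceStencil] <;> linarith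

/-! ### Solvability of the linear system -/

/-- The displayed sum is the coefficient of `h^(n+i)` in the `n`-th equation of the system, `σ n j`
being the degree `j` part of `G_{n,0}`. The newest level `c i` enters only through `σ n n`, so the
levels are found one after another from moment conditions. -/
lemma exists_stencil_levels {p q : ℝ} {σ : ℕ → ℕ → Stencil → ℝ}
    (hσ : ∀ n s, σ n n s = harmonicSlice n s)
    (hσ' : ∀ n s, σ n (n + 1) s = correctionSlice p q n s) (I : ℕ) :
    ∃ c : ℕ → Stencil → ℝ, c 0 = laplaceStencil ∧ ∀ i ≤ I, ∀ n, n + i ≤ 6 →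
      ∑ i' ∈ Finset.range (i + 1), ∑ s, c i' s * σ n (n + i - i') s = 0 := by
  induction I with
  | zero =>
    refine ⟨fun _ => laplaceStencil, rfl, fun i hi n hn => ?_⟩
    obtain rfl : i = 0 := by omega
    simp [hσ, sum_laplaceStencil_harmonicSlice (show n ≤ 6 by omega)]
  | succ I ih =>
    obtain ⟨c, hc0, hc⟩ := ih
    set b : ℕ → ℝ := fun n => -∑ i' ∈ Finset.range (I + 1), ∑ s, c i' s * σ n (n + (I + 1) - i') s
      with hb
    obtain ⟨v, hv⟩ := exists_stencil_harmonicSlice_eq b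
    have hv' : ∀ n, n + (I + 1) ≤ 6 → ∑ s, v s * harmonicSlice n s = b n := by
      intro n hn
      rcases Nat.lt_or_ge 4 n with h4 | h4
      swap
      · exact hv n h4
      -- A moment beyond the freely prescribed ones is needed only at level 1, for `n = 5`; there
      -- the relation between the degrees 1, 3 and 5 supplies it.
      obtain rfl : I = 0 := by omega
      obtain rfl : n = 5 := by omega
      have h1 : ∑ s, v s * (2 * harmonicSlice 1 s - 30 * harmonicSlice 3 s
          + 360 * harmonicSlice 5 s) = 0 :=
        Finset.sum_eq_zero fun s _ => by rw [harmonicSlice_relation, mul_zero]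
      have h2 := sum_laplaceStencil_correctionSlice_odd p q
      have e : ∀ w A B C : Stencil → ℝ, ∑ s, w s * (2 * A s - 30 * B s + 360 * C s)
          = 2 * ∑ s, w s * A s - 30 * ∑ s, w s * B s + 360 * ∑ s, w s * C s := by
        intro w A B C
        simp only [Finset.mul_sum, ← Finset.sum_add_distrib, ← Finset.sum_sub_distrib]
        exact Finset.sum_congr rfl fun s _ => by ring
      rw [e] at h1 h2
      have hb1 : ∀ n, b n = -∑ s, laplaceStencil s * correctionSlice p q n s := fun n => by
        simp [hb, hc0, hσ']
      rw [hv 1 (by norm_num), hv 3 (by norm_num), hb1, hb1] at h1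
      rw [hb1]
      linarith
    have hne : ∀ i ∈ Finset.range (I + 1), i ≠ I + 1 := fun i hi => by
      rw [Finset.mem_range] at hi
      omega
    refine ⟨Function.update c (I + 1) v, by simp [hc0], fun i hi n hn => ?_⟩
    rcases Nat.lt_or_ge i (I + 1) with hlt | hge
    · rw [← hc i (by omega) n hn]
      refine Finset.sum_congr rfl fun i' hi' => ?_
      rw [Finset.mem_range] at hi'
      rw [Function.update_of_ne (by omega)]
    · obtain rfl : i = I + 1 := by omega
      rw [Finset.sum_range_succ, Finset.sum_congr rfl fun i' hi' => by
        rw [Function.update_of_ne (hne i' hi')], Function.update_self, Nat.add_sub_cancel]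
      simp only [hσ, hv' n hn, hb]
      ring

/-- A polynomial product without terms of degree at most six. -/
lemma isBigO_pow_seven {A : ℕ → ℕ → ℝ}
    (hA : ∀ d ≤ 6, ∑ r ∈ Finset.HasAntidiagonal.antidiagonal d, A r.1 r.2 = 0) :
    (fun h : ℝ => ∑ i ∈ Finset.range 7, ∑ j ∈ Finset.range 7, h ^ (i + j) * A i j)
      =O[𝓝[>] 0] fun h => h ^ 7 := by
  have hsplit : ∀ h : ℝ, ∑ i ∈ Finset.range 7, ∑ j ∈ Finset.range 7, h ^ (i + j) * A i j
      = ∑ r ∈ (Finset.range 7 ×ˢ Finset.range 7).filter (fun r => ¬ r.1 + r.2 ≤ 6),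
        h ^ (r.1 + r.2) * A r.1 r.2 := by
    intro h
    rw [← Finset.sum_product' (f := fun i j => h ^ (i + j) * A i j),
      ← Finset.sum_filter_add_sum_filter_not _ (fun r : ℕ × ℕ => r.1 + r.2 ≤ 6)]
    have h0 : ∑ r ∈ Lam 6, h ^ (r.1 + r.2) * A r.1 r.2 = 0 := by
      rw [sum_Lam_eq_sum_antidiagonal]
      refine Finset.sum_eq_zero fun d hd => ?_
      rw [Finset.mem_range] at hd
      rw [← mul_zero (h ^ d), ← hA d (by omega), Finset.mul_sum]
      refine Finset.sum_congr rfl fun r hr => ?_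
      rw [Finset.HasAntidiagonal.mem_antidiagonal.mp hr]
    rw [Lam] at h0
    rw [h0, zero_add]
  refine IsBigO.congr_left ?_ fun h => (hsplit h).symm
  refine IsBigO.fun_sum fun r hr => ?_
  rw [Finset.mem_filter] at hr
  have h1 : (fun h : ℝ => h ^ (r.1 + r.2)) =O[𝓝[>] 0] fun h : ℝ => h ^ 7 := by
    refine IsBigO.of_bound 1 (eventually_nhdsWithin_of_eventually_nhds ?_)
    filter_upwards [Metric.ball_mem_nhds (0 : ℝ) one_pos] with h hh
    rw [Metric.mem_ball, dist_zero_right] at hh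
    rw [one_mul, norm_pow, norm_pow]
    exact pow_le_pow_of_le_one (norm_nonneg h) hh.le (by omega)
  simpa only [mul_comm] using h1.const_mul_left (A r.1 r.2)

lemma slice_AHu (S : Set (ℝ × ℝ)) (a : ℝ × ℝ → ℝ) (z₀ : ℝ × ℝ) (n : ℕ) (s : Stencil) :
    slice (fun m i => AHu S a z₀ m i n 0) n s = harmonicSlice n s ∧
    slice (fun m i => AHu S a z₀ m i n 0) (n + 1) s
      = correctionSlice (partialX S a z₀ / a z₀) (partialY S a z₀ / a z₀) n s ∧
    ∀ j < n, slice (fun m i => AHu S a z₀ m i n 0) j s = 0 :=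
  ⟨slice_congr (fun _ _ h => forcedJet_single_eq_harmonicCoeff _ _ _ h) s,
    slice_congr (fun _ _ h => forcedJet_single_eq_correctionCoeff _ _ _ h) s,
    fun _ hj => slice_eq_zero (fun _ _ h => forcedJet_single_eq_zero _ _ _ (h ▸ hj)) s⟩

theorem exists_solvesNeumannSystem (D : InterfaceDomain) (a : ℝ × ℝ → ℝ) (x₀ : ℝ) :
    ∃ c : Stencil → Fin 7 → ℝ, (∃ s, c s 0 ≠ 0) ∧ SolvesNeumannSystem D a x₀ c := by
  set σ : ℕ → ℕ → Stencil → ℝ := fun n j s =>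
    slice (fun m i => AHu D.region a (x₀, D.l₃) m i n 0) j s with hσ
  have hA := slice_AHu D.region a (x₀, D.l₃)
  obtain ⟨c, hc0, hc⟩ := exists_stencil_levels (σ := σ) (fun n s => (hA n s).1)
    (fun n s => (hA n s).2.1) 6
  refine ⟨fun s i => c i s, ⟨(0, 0), by simp [hc0, laplaceStencil]⟩, fun n hn => ?_⟩
  have hmain := isBigO_pow_seven (A := fun i j => ∑ s, c i s * σ n j s) fun d hd => by
    rw [Finset.Nat.sum_antidiagonal_eq_sum_range_succ_mk]
    simp only
    -- `G_{n,0}` has no terms of degree below `n`, so only the levels `i' ≤ d - n` contribute to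
    -- `h^d`.
    have hzero : ∀ i' ≤ d, d < n + i' → ∑ s, c i' s * σ n (d - i') s = 0 := fun i' hd hi' =>
      Finset.sum_eq_zero fun s _ => by simp only [hσ, (hA n s).2.2 (d - i') (by omega), mul_zero]
    rcases Nat.lt_or_ge d n with h | h
    · exact Finset.sum_eq_zero fun i' hi' => hzero i' (by
        rw [Finset.mem_range] at hi'; omega) (by omega)
    · rw [← Finset.sum_subset (s₁ := Finset.range (d - n + 1))]
      · have := hc (d - n) (by omega) n (by omega)
        rwa [Nat.add_sub_of_le h] at this
      · exact Finset.range_subset_range.mpr (by omega)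
      · intro i' hd hi'
        rw [Finset.mem_range] at hd hi'
        exact hzero i' (by omega) (by omega)
  refine hmain.congr_left fun h => ?_
  have hterm : ∀ s : Stencil, stencilCoeff (fun s i => c i s) s h
      * GH D.region a (x₀, D.l₃) 5 n 0 (s.k * h) (s.l * h)
      = ∑ i ∈ Finset.range 7, ∑ j ∈ Finset.range 7, h ^ (i + j) * (c i s * σ n j s) := by
    intro s
    rw [GH_eq_sum _ _ _ (zero_le_one : 0 ≤ 1) (show n + 0 ≤ 5 + 1 by omega),
      sum_Lam_stencil 6 (fun m i => AHu D.region a (x₀, D.l₃) m i n 0), stencilCoeff,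
      Fin.sum_univ_eq_sum_range (fun i => c i s * h ^ i) 7, Finset.sum_mul_sum]
    refine Finset.sum_congr rfl fun i _ => Finset.sum_congr rfl fun j _ => ?_
    rw [pow_add]
    ring
  simp only [hterm, Finset.mul_sum]
  symm
  rw [Finset.sum_comm]
  exact Finset.sum_congr rfl fun i _ => Finset.sum_comm

/-! ### Smooth exact solutions -/

lemma dirD_eqOn_univ {S : Set (ℝ × ℝ)} (hS : UniqueDiffOn ℝ S) {u : ℝ × ℝ → ℝ}
    (hu : ContDiff ℝ ∞ u) (e : ℝ × ℝ) : EqOn (dirD S e u) (dirD univ e u) S := fun z hz => by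
  simp only [dirD, fderivWithin_univ]
  rw [fderivWithin_eq_fderiv (hS z hz) (hu.differentiable (by simp) z)]

lemma contDiff_dirD_univ {u : ℝ × ℝ → ℝ} (hu : ContDiff ℝ ∞ u) (e : ℝ × ℝ) :
    ContDiff ℝ ∞ (dirD univ e u) := by
  unfold dirD
  simp only [fderivWithin_univ]
  exact (hu.fderiv_right (m := ∞) (by simp)).clm_apply contDiff_const

lemma dirD_iterate_eqOn_univ {S : Set (ℝ × ℝ)} (hS : UniqueDiffOn ℝ S) {u : ℝ × ℝ → ℝ}
    (hu : ContDiff ℝ ∞ u) (e : ℝ × ℝ) (m : ℕ) :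
    EqOn ((dirD S e)^[m] u) ((dirD univ e)^[m] u) S ∧ ContDiff ℝ ∞ ((dirD univ e)^[m] u) := by
  induction m generalizing u with
  | zero => exact ⟨fun _ _ => rfl, hu⟩
  | succ m ih =>
    simp only [Function.iterate_succ_apply]
    have h := ih (contDiff_dirD_univ hu e)
    exact ⟨(dirD_iterate_congr m (dirD_eqOn_univ hS hu e)).trans h.1, h.2⟩

lemma partialD_eqOn_univ {S : Set (ℝ × ℝ)} (hS : UniqueDiffOn ℝ S) {u : ℝ × ℝ → ℝ}
    (hu : ContDiff ℝ ∞ u) (m n : ℕ) :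
    EqOn (partialD S m n u) (partialD univ m n u) S ∧ ContDiff ℝ ∞ (partialD univ m n u) := by
  have h1 := dirD_iterate_eqOn_univ hS hu (0, 1) n
  have h2 := dirD_iterate_eqOn_univ hS h1.2 (1, 0) m
  exact ⟨(dirD_iterate_congr m h1.1).trans h2.1, h2.2⟩

namespace InterfaceDomain

variable {D : InterfaceDomain}

/-- On the region the relative derivatives are those on the whole plane, which are continuous on the
compact rectangle and therefore uniformly continuous. -/
lemma piecewiseSmooth_of_contDiff {u : ℝ × ℝ → ℝ} (hu : ContDiff ℝ ∞ u) (k : ℕ∞) :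
    D.PiecewiseSmooth k u := by
  have key : ∀ i j : ℕ, ∀ T ⊆ D.Ω \ D.interface,
      UniformContinuousOn (partialD D.region i j u) T := fun i j T hT => by
    have h := partialD_eqOn_univ D.uniqueDiffOn_region hu i j
    have hc := (isCompact_Icc (a := D.l₁) (b := D.l₂)).prod (isCompact_Icc (a := D.l₃) (b := D.l₄))
      |>.uniformContinuousOn_of_continuous h.2.continuous.continuousOn
    exact (hc.mono fun z hz => D.Ω_subset_rectangle (hT hz).1).congr fun z hz =>
      (h.1 (D.Ω_diff_interface_subset (hT hz))).symm
  exact ⟨hu.contDiffOn.of_le (by exact_mod_cast le_top), fun i j _ => key i j _ D.Ωpos_subset,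
    fun i j _ => key i j _ D.Ωneg_subset⟩

/-- Every smooth function on the plane is an exact solution for suitable data. -/
lemma isSolution_of_contDiff {k : ℕ∞} {a u : ℝ × ℝ → ℝ} (ha : D.PiecewiseSmooth (k + 1) a)
    (hu : ContDiff ℝ ∞ u) :
    D.IsSolution k a u
      (fun z => -(partialX D.region (fun w => a w * partialX D.region u w) z
        + partialY D.region (fun w => a w * partialY D.region u w) z))
      (fun x => -dirD univ (0, 1) u (x, D.l₃)) := by
  have hS := D.uniqueDiffOn_region
  have hcomp : ContDiff ℝ ∞ fun x : ℝ => -dirD univ (0, 1) u (x, D.l₃) :=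
    ((contDiff_dirD_univ hu (0, 1)).comp (contDiff_id.prodMk contDiff_const)).neg
  have hflux : ∀ e : ℝ × ℝ, ContDiffOn ℝ k (dirD D.region e fun w => a w * dirD D.region e u w)
      D.region := fun e => by
    have h1 : ContDiffOn ℝ (k + 1 : ℕ∞) (dirD D.region e u) D.region :=
      (((contDiff_dirD_univ hu e).contDiffOn).congr (dirD_eqOn_univ hS hu e)).of_le
        (by exact_mod_cast le_top)
    exact ((ha.contDiffOn.mul h1).fderivWithin hS (by norm_cast)).clm_apply contDiffOn_const
  refine ⟨piecewiseSmooth_of_contDiff hu _, ((hflux (1, 0)).add (hflux (0, 1))).neg,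
    hcomp.contDiffOn.of_le (by exact_mod_cast le_top), fun j _ => ?_, fun z _ => rfl,
    fun x hx hreg => ?_⟩
  · exact ((isCompact_Icc (a := D.l₁) (b := D.l₂)).uniformContinuousOn_of_continuous
      (hcomp.continuous_iteratedDeriv j (by exact_mod_cast le_top)).continuousOn).mono
      Ioo_subset_Icc_self
  · have h := dirD_eqOn_univ hS hu (0, 1) (mem_region_bottom hx hreg)
    rw [← h, dirD, ← map_neg]
    simp

end InterfaceDomain

/-! ### Upper bounds for the order -/

/-- A family of vectors which does not tend to zero can be normalized to converge to a nonzero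
vector along a finer filter. -/
lemma exists_normalized_limit {C : Stencil → ℝ → ℝ}
    (h : ¬ Tendsto (fun h s => C s h) (𝓝[>] (0 : ℝ)) (𝓝 (0 : Stencil → ℝ))) :
    ∃ (U : Filter ℝ) (w : ℝ → Stencil → ℝ) (v : Stencil → ℝ), U.NeBot ∧ U ≤ 𝓝[>] 0 ∧
      Tendsto w U (𝓝 v) ∧ v ≠ 0 ∧ ∀ (φ : ℝ → Stencil → ℝ) (ρ : ℝ → ℝ),
        (fun h => ∑ s, C s h * φ h s) =O[𝓝[>] 0] ρ → (fun h => ∑ s, w h s * φ h s) =O[U] ρ := by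
  set c : ℝ → Stencil → ℝ := fun h s => C s h with hc
  rw [Metric.tendsto_nhds] at h
  push Not at h
  obtain ⟨ε, hε, hfreq⟩ := h
  have hne : (𝓝[>] (0 : ℝ) ⊓ 𝓟 {h | ε ≤ ‖c h‖}).NeBot := by
    rw [← frequently_mem_iff_neBot]
    refine hfreq.mono fun h hh => ?_
    simpa [hc] using hh
  -- The ultrafilter plays the role of a subsequence: the unit sphere is compact, so the normalized
  -- vectors converge along it, and `‖c h‖⁻¹ ≤ ε⁻¹` preserves every `O` bound.
  set U : Ultrafilter ℝ := Ultrafilter.of (𝓝[>] (0 : ℝ) ⊓ 𝓟 {h | ε ≤ ‖c h‖}) with hU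
  have hUle : (U : Filter ℝ) ≤ 𝓝[>] (0 : ℝ) ⊓ 𝓟 {h | ε ≤ ‖c h‖} := Ultrafilter.of_le _
  have hUε : ∀ᶠ h in (U : Filter ℝ), ε ≤ ‖c h‖ := (hUle.trans inf_le_right) (mem_principal_self _)
  set w : ℝ → Stencil → ℝ := fun h => ‖c h‖⁻¹ • c h with hw
  have hsphere : ((U.map w : Ultrafilter _) : Filter (Stencil → ℝ))
      ≤ 𝓟 (Metric.sphere (0 : Stencil → ℝ) 1) := by
    have hmem : ∀ᶠ h in (U : Filter ℝ), w h ∈ Metric.sphere (0 : Stencil → ℝ) 1 := by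
      filter_upwards [hUε] with h hh
      have : ‖c h‖ ≠ 0 := (hε.trans_le hh).ne'
      simp [hw, norm_smul, this]
    rw [le_principal_iff]
    exact hmem
  obtain ⟨v, hv, hlim⟩ := (isCompact_sphere (0 : Stencil → ℝ) 1).ultrafilter_le_nhds _ hsphere
  refine ⟨U, w, v, U.neBot, hUle.trans inf_le_left, hlim, ?_, fun φ ρ hφ => ?_⟩
  · rintro rfl
    simp at hv
  · have h1 := hφ.mono (hUle.trans inf_le_left)
    have h2 : (fun h => ‖c h‖⁻¹) =O[(U : Filter ℝ)] fun _ => (1 : ℝ) := by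
      refine IsBigO.of_bound ε⁻¹ ?_
      filter_upwards [hUε] with h hh
      rw [norm_inv, norm_norm, norm_one, mul_one]
      exact inv_anti₀ hε hh
    have h3 := h2.mul h1
    simp only [one_mul] at h3
    refine h3.congr_left fun h => ?_
    rw [Finset.mul_sum]
    refine Finset.sum_congr rfl fun s _ => ?_
    simp only [hw, hc, Pi.smul_apply, smul_eq_mul]
    ring

lemma isBigO_of_pow_mul {U : Filter ℝ} (hU : U ≤ 𝓝[>] 0) {ν n : ℕ} {G : ℝ → ℝ}
    (h : (fun t => t ^ ν * G t) =O[U] fun t => t ^ (ν + n)) : G =O[U] fun t => t ^ n := by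
  obtain ⟨C, hC⟩ := h.bound
  refine IsBigO.of_bound C ?_
  filter_upwards [hC, hU self_mem_nhdsWithin] with t ht ht0
  have ht0' : (0 : ℝ) < t := ht0
  have hpos : 0 < ‖t ^ ν‖ := norm_pos_iff.mpr (pow_pos ht0' ν).ne'
  rw [pow_add, norm_mul, norm_mul, mul_left_comm] at ht
  exact le_of_mul_le_mul_left ht hpos

namespace SixPointScheme

variable {D : InterfaceDomain} {a : ℝ × ℝ → ℝ} {x₀ : ℝ} {σ : SixPointScheme} {k : ℕ∞} {N K p : ℕ}

open InterfaceDomain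

/-- Polynomial exact solutions whose data are not seen by the scheme. -/
lemma HasOrder.sum_slice_isBigO (hσ : σ.HasOrder D a x₀ k N K p) (hp : 7 ≤ p)
    (hN : (N : ℕ∞) ≤ k) (hK : (K : ℕ∞) ≤ k) (ha : D.PiecewiseSmooth (k + 1) a)
    (ha_pos : ∀ z ∈ D.region, 0 < a z) (hx₀ : x₀ ∈ Ioo D.l₁ D.l₂)
    (hreg : (x₀, D.l₃) ∉ closure D.interface) {M : ℕ} {J : ℕ → ℕ → ℝ} {d : ℕ × ℕ → ℝ}
    (hJM : ∀ m n, M < m + n → J m n = 0) (hJ1 : ∀ m, J m 1 = 0)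
    (hJd : ∀ m n, m + n ≤ N + 2 → J m n = coeffJet D.region a (x₀, D.l₃) d 0 m n) :
    (fun h => ∑ s, σ.C s h * ∑ j ∈ Finset.range (M + 1), h ^ j * slice J j s)
      =O[𝓝[>] 0] fun h => h ^ 8 := by
  have hS := D.uniqueDiffOn_region
  have hz := mem_region_bottom hx₀ hreg
  have hu : ContDiff ℝ ∞ (taylorPoly (x₀, D.l₃) M J) := contDiff_taylorPoly _ _ _
  have hsol := isSolution_of_contDiff (k := k) ha hu
  have hjet : ∀ m n, partialD D.region m n (taylorPoly (x₀, D.l₃) M J) (x₀, D.l₃) = J m n :=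
    fun m n => partialD_taylorPoly_self hS hz hJM m n
  have hf := fun (m n : ℕ) (hmn : m + n ≤ N) => source_jet_eq_zero (N := N) hS D.region_subset_closure_interior
    (ha.contDiffOn_nat (by push_cast; gcongr)) ha_pos (contDiff_taylorPoly _ _ _).contDiffOn
    (hsol.smooth_f.of_le (by exact_mod_cast hN))
    (hsol.pde_region (ha.contDiffOn_nat (by simp))) hz
    (d := d) (fun m n hmn => by rw [hjet, hJd m n hmn]) hmn
  have h1 := hσ _ _ _ hsol
  have hpow : (fun h : ℝ => h ^ (p + 1)) =O[𝓝[>] 0] fun h : ℝ => h ^ 8 := by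
    refine IsBigO.of_bound 1 (eventually_nhdsWithin_of_eventually_nhds ?_)
    filter_upwards [Metric.ball_mem_nhds (0 : ℝ) one_pos] with h hh
    rw [Metric.mem_ball, dist_zero_right] at hh
    rw [one_mul, norm_pow, norm_pow]
    exact pow_le_pow_of_le_one (norm_nonneg h) hh.le (by omega)
  refine (h1.trans hpow).congr_left fun h => ?_
  rw [residual, Finset.sum_eq_zero (s := Lam N), Finset.sum_eq_zero (s := Finset.range (K + 1))]
  · rw [add_zero, sub_zero]
    refine Finset.sum_congr rfl fun s _ => ?_
    rw [← sum_Lam_stencil, ← taylorPoly_eq_sum_Lam (x₀, D.l₃) hJM]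
  · intro n hn
    rw [Finset.mem_range] at hn
    rw [hsol.iteratedDeriv_neumann (le_trans (by exact_mod_cast Nat.lt_succ_iff.mp hn) hK) hx₀ hreg,
      hjet, hJ1, neg_zero, zero_mul]
  · intro r hr
    rw [hf _ _ (mem_Lam.mp hr), zero_mul]

/-- Along a suitable filter the normalized coefficients converge, and satisfy the conditions which
the polynomial exact solutions impose. -/
lemma HasOrder.exists_limit (hσ : σ.HasOrder D a x₀ k N K p) (hnt : σ.Nontrivial) (hp : 7 ≤ p)
    (hN : (N : ℕ∞) ≤ k) (hK : (K : ℕ∞) ≤ k) (ha : D.PiecewiseSmooth (k + 1) a)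
    (ha_pos : ∀ z ∈ D.region, 0 < a z) (hx₀ : x₀ ∈ Ioo D.l₁ D.l₂)
    (hreg : (x₀, D.l₃) ∉ closure D.interface) :
    ∃ (U : Filter ℝ) (w : ℝ → Stencil → ℝ) (v : Stencil → ℝ), U.NeBot ∧ U ≤ 𝓝[>] 0 ∧
      Tendsto w U (𝓝 v) ∧ v ≠ 0 ∧ ∀ (ν n B : ℕ) (J : ℕ → ℕ → ℝ) (d : ℕ × ℕ → ℝ), ν + n = 8 →
        (∀ m n, ν + B < m + n → J m n = 0) → (∀ m, J m 1 = 0) →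
        (∀ m n, m + n ≤ N + 2 → J m n = coeffJet D.region a (x₀, D.l₃) d 0 m n) →
        (∀ j < ν, ∀ s, slice J j s = 0) →
        (fun h => ∑ s, w h s * ∑ j ∈ Finset.range (B + 1), h ^ j * slice J (ν + j) s)
          =O[U] fun h => h ^ n := by
  obtain ⟨U, w, v, hne, hU, hlim, hv, htrans⟩ := exists_normalized_limit hnt
  refine ⟨U, w, v, hne, hU, hlim, hv, fun ν n B J d hν hJM hJ1 hJd hJ0 => ?_⟩
  have h := htrans _ _ (hσ.sum_slice_isBigO hp hN hK ha ha_pos hx₀ hreg hJM hJ1 hJd)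
  -- The homogeneous parts below degree `ν` vanish, so `h ^ ν` can be divided out of the bound
  -- `O(h^8)`.
  rw [← hν] at h
  refine isBigO_of_pow_mul hU (ν := ν) (h.congr_left fun t => ?_)
  rw [Finset.mul_sum _ _ (t ^ ν)]
  refine Finset.sum_congr rfl fun s _ => ?_
  rw [add_assoc, Finset.sum_range_add, Finset.sum_eq_zero fun j hj => by
    rw [hJ0 j (Finset.mem_range.mp hj), mul_zero], zero_add, mul_left_comm, Finset.mul_sum _ _ (t ^ ν)]
  congr 1
  refine Finset.sum_congr rfl fun j _ => ?_
  rw [pow_add, mul_assoc]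

lemma tendsto_sum_slice {U : Filter ℝ} (hU : U ≤ 𝓝[>] 0) {w : ℝ → Stencil → ℝ} {v : Stencil → ℝ}
    (hw : Tendsto w U (𝓝 v)) (Φ : ℝ → Stencil → ℝ) (hΦ : ∀ s, Continuous fun h => Φ h s) :
    Tendsto (fun h => ∑ s, w h s * Φ h s) U (𝓝 (∑ s, v s * Φ 0 s)) :=
  tendsto_finsetSum _ fun s _ => ((tendsto_pi_nhds.mp hw s).mul
    (((hΦ s).tendsto 0).mono_left (hU.trans nhdsWithin_le_nhds)))

lemma tendsto_zero_of_isBigO {U : Filter ℝ} (hU : U ≤ 𝓝[>] 0) {G : ℝ → ℝ} {n : ℕ} (hn : n ≠ 0)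
    (h : G =O[U] fun t => t ^ n) : Tendsto G U (𝓝 0) := by
  refine h.trans_tendsto ?_
  have : Tendsto (fun t : ℝ => t ^ n) (𝓝 0) (𝓝 (0 ^ n)) := (continuous_pow n).tendsto 0
  rw [zero_pow hn] at this
  exact this.mono_left (hU.trans nhdsWithin_le_nhds)

end SixPointScheme

lemma slice_truncate {J : ℕ → ℕ → ℝ} {M j : ℕ} (hj : j ≤ M) (s : Stencil) :
    slice (fun m n => if m + n ≤ M then J m n else 0) j s = slice J j s :=
  slice_congr (fun m n h => if_pos (by omega)) s

namespace SixPointScheme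

variable {D : InterfaceDomain} {a : ℝ × ℝ → ℝ} {x₀ : ℝ} {σ : SixPointScheme} {k : ℕ∞} {N K p : ℕ}

open InterfaceDomain

lemma sum_slice_eq_zero {U : Filter ℝ} [U.NeBot] (hU : U ≤ 𝓝[>] 0) {w : ℝ → Stencil → ℝ}
    {v : Stencil → ℝ} (hw : Tendsto w U (𝓝 v)) {ν n B : ℕ} {J : ℕ → ℕ → ℝ} (hn : n ≠ 0)
    (h : (fun h => ∑ s, w h s * ∑ j ∈ Finset.range (B + 1), h ^ j * slice J (ν + j) s)
      =O[U] fun h => h ^ n) : ∑ s, v s * slice J ν s = 0 := by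
  have h1 := tendsto_sum_slice hU hw
    (fun h s => ∑ j ∈ Finset.range (B + 1), h ^ j * slice J (ν + j) s) fun s => by fun_prop
  rw [← tendsto_nhds_unique h1 (tendsto_zero_of_isBigO hU hn h)]
  refine Finset.sum_congr rfl fun s _ => ?_
  rw [Finset.sum_range_succ']
  simp

/-- If the order exceeds six then the normalized coefficients converge to a multiple of the Laplace
stencil, and they satisfy the conditions imposed by polynomial exact solutions. -/
lemma HasOrder.exists_limit_eq_laplaceStencil (hσ : σ.HasOrder D a x₀ k N K p)
    (hnt : σ.Nontrivial) (hp : 7 ≤ p) (hN : (N : ℕ∞) ≤ k) (hK : (K : ℕ∞) ≤ k)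
    (ha : D.PiecewiseSmooth (k + 1) a) (ha_pos : ∀ z ∈ D.region, 0 < a z)
    (hx₀ : x₀ ∈ Ioo D.l₁ D.l₂) (hreg : (x₀, D.l₃) ∉ closure D.interface) :
    ∃ (U : Filter ℝ) (w : ℝ → Stencil → ℝ) (c : ℝ), U.NeBot ∧ U ≤ 𝓝[>] 0 ∧
      Tendsto w U (𝓝 fun s => c * laplaceStencil s) ∧ c ≠ 0 ∧
      (∀ (ν n B : ℕ) (J : ℕ → ℕ → ℝ) (d : ℕ × ℕ → ℝ), ν + n = 8 →
        (∀ m n, ν + B < m + n → J m n = 0) → (∀ m, J m 1 = 0) →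
        (∀ m n, m + n ≤ N + 2 → J m n = coeffJet D.region a (x₀, D.l₃) d 0 m n) →
        (∀ j < ν, ∀ s, slice J j s = 0) →
        (fun h => ∑ s, w h s * ∑ j ∈ Finset.range (B + 1), h ^ j * slice J (ν + j) s)
          =O[U] fun h => h ^ n) ∧
      ∀ ν n B : ℕ, ν + n = 8 → N + 2 ≤ ν + B →
        (fun h => ∑ s, w h s * ∑ j ∈ Finset.range (B + 1), h ^ j *
          slice (fun m i => AHu D.region a (x₀, D.l₃) m i ν 0) (ν + j) s)
          =O[U] fun h => h ^ n := by
  obtain ⟨U, w, v, hne, hU, hlim, hv, htest⟩ := hσ.exists_limit hnt hp hN hK ha ha_pos hx₀ hreg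
  have hA := slice_AHu D.region a (x₀, D.l₃)
  -- The test function has the forced jet of the datum `u^{(ν,0)} = 1`, cut off above order `ν + B`.
  -- The cut lies at or beyond order `N + 2`, so the source derivatives seen by the scheme still
  -- vanish.
  have hforced : ∀ ν n B : ℕ, ν + n = 8 → N + 2 ≤ ν + B →
      (fun h => ∑ s, w h s * ∑ j ∈ Finset.range (B + 1), h ^ j *
        slice (fun m i => AHu D.region a (x₀, D.l₃) m i ν 0) (ν + j) s)
        =O[U] fun h => h ^ n := by
    intro ν n B hν hB
    refine (htest ν n B (fun m i => if m + i ≤ ν + B then AHu D.region a (x₀, D.l₃) m i ν 0 else 0)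
      (Pi.single (ν, 0) 1) hν (fun m i h => if_neg (by omega)) (fun m => ?_)
      (fun m i h => if_pos (by omega)) (fun j hj s => ?_)).congr_left fun h => ?_
    · have : AHu D.region a (x₀, D.l₃) m 1 ν 0 = 0 := by
        simp [AHu, coeffJet, forcedJet_one]
      simp [this]
    · rw [slice_truncate (by omega), (hA ν s).2.2 j hj]
    · refine Finset.sum_congr rfl fun s _ => ?_
      congr 1
      refine Finset.sum_congr rfl fun j hj => ?_
      rw [Finset.mem_range] at hj
      rw [slice_truncate (by omega)]
  -- After division by `h ^ n` the bound `O(h^(8-n))` tends to zero, and the leading term is the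
  -- `n`-th harmonic moment of the limit.
  obtain ⟨c, hc⟩ := eq_smul_laplaceStencil (v := v) fun n hn => by
    have h := sum_slice_eq_zero hU hlim (by omega)
      (hforced n (8 - n) (N + 2) (by omega) (by omega))
    simpa only [(hA n _).1] using h
  refine ⟨U, w, c, hne, hU, hc ▸ hlim, ?_, htest, hforced⟩
  rintro rfl
  exact hv (by rw [hc]; ext s; simp)

/-- With derivatives of the source of order at most four, the order is at most six. -/
theorem HasOrder.le_six (hσ : σ.HasOrder D a x₀ 5 4 5 p) (hnt : σ.Nontrivial)
    (ha : D.PiecewiseSmooth 6 a) (ha_pos : ∀ z ∈ D.region, 0 < a z)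
    (hx₀ : x₀ ∈ Ioo D.l₁ D.l₂) (hreg : (x₀, D.l₃) ∉ closure D.interface) : p ≤ 6 := by
  by_contra! hp
  obtain ⟨U, w, c, hne, hU, hlim, hc, htest, -⟩ := hσ.exists_limit_eq_laplaceStencil hnt hp
    (by norm_num) (by norm_num) (by norm_num; exact ha) ha_pos hx₀ hreg
  -- The test function is `(y-l₃)^7/7!`. Its jet up to order `N + 2 = 6` is zero, so neither the
  -- source nor the Neumann data are seen, while the Laplace stencil gives it the value `6/7!`.
  have hlt : ∀ j < 7, ∀ s, slice (fun m n => if m = 0 ∧ n = 7 then 1 else 0) j s = 0 :=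
    fun j hj s => slice_eq_zero (fun m n h => if_neg (by omega)) s
  have h := sum_slice_eq_zero hU hlim one_ne_zero
    (htest 7 1 0 (fun m n => if m = 0 ∧ n = 7 then 1 else 0) 0 rfl
      (fun m n h => if_neg (by omega)) (fun m => if_neg (by omega))
      (fun m n h => by rw [coeffJet, forcedJet_zero_data, if_neg (by omega)]) hlt)
  have hslice : ∀ s : Stencil, slice (fun m n => if m = 0 ∧ n = 7 then 1 else 0) 7 s
      = s.l ^ 7 / 5040 := fun s => by
    rw [slice, Finset.sum_eq_single (0, 7)]
    · simp [taylorMonomial, Nat.factorial]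
    · intro r _ hr
      rw [if_neg, zero_mul]
      rintro ⟨h0, h7⟩
      exact hr (Prod.ext h0 h7)
    · intro h
      exact absurd (Finset.HasAntidiagonal.mem_antidiagonal.mpr (by norm_num)) h
  simp [hslice, sum_stencil, laplaceStencil, Stencil.l] at h
  exact hc (by linarith)

/-- If the normal derivative of the coefficient does not vanish, the order is at most six. -/
theorem HasOrder.le_six_of_partialY_ne_zero (hσ : σ.HasOrder D a x₀ ⊤ N K p) (hnt : σ.Nontrivial)
    (ha : D.PiecewiseSmooth ⊤ a) (ha_pos : ∀ z ∈ D.region, 0 < a z)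
    (hx₀ : x₀ ∈ Ioo D.l₁ D.l₂) (hreg : (x₀, D.l₃) ∉ closure D.interface)
    (hy : partialY D.region a (x₀, D.l₃) ≠ 0) : p ≤ 6 := by
  by_contra! hp
  obtain ⟨U, w, c, hne, hU, hlim, hc, -, hforced⟩ := hσ.exists_limit_eq_laplaceStencil hnt hp
    le_top le_top ha ha_pos hx₀ hreg
  have hA := slice_AHu D.region a (x₀, D.l₃)
  set σ' : ℕ → ℕ → Stencil → ℝ := fun ν j s =>
    slice (fun m i => AHu D.region a (x₀, D.l₃) m i ν 0) j s with hσ'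
  have h2 : (fun h => ∑ s, w h s * ∑ j ∈ Finset.range (N + 1 + 1), h ^ j * σ' 2 (2 + j) s)
      =O[U] fun h => h ^ 2 := by
    refine (hforced 2 6 (N + 1) rfl (by omega)).trans (IsBigO.mono ?_ (hU.trans nhdsWithin_le_nhds))
    exact IsBigO.of_bound 1 (by
      filter_upwards [Metric.ball_mem_nhds (0 : ℝ) one_pos] with h hh
      rw [Metric.mem_ball, dist_zero_right] at hh
      rw [one_mul, norm_pow, norm_pow]
      exact pow_le_pow_of_le_one (norm_nonneg h) hh.le (by norm_num))
  have h6 : (fun h => ∑ s, w h s * ∑ j ∈ Finset.range (N + 1 + 1), h ^ j * σ' 6 (6 + j) s)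
      =O[U] fun h => h ^ 2 := hforced 6 2 (N + 1) rfl (by omega)
  -- The combination of the test functions of degrees 6 and 2 that annihilates the leading terms at
  -- each stencil point, with a further factor `h` removed.
  set Φ : ℝ → Stencil → ℝ := fun h s => ∑ j ∈ Finset.range (N + 1), h ^ j *
    (720 * σ' 6 (6 + (j + 1)) s - 2 * σ' 2 (2 + (j + 1)) s) with hΦ
  have hcomb : (fun h => h ^ 1 * ∑ s, w h s * Φ h s) =O[U] fun h => h ^ (1 + 1) := by
    refine ((h6.const_mul_left 720).sub (h2.const_mul_left 2)).congr_left fun h => ?_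
    rw [Finset.mul_sum, Finset.mul_sum, ← Finset.sum_sub_distrib, Finset.mul_sum]
    refine Finset.sum_congr rfl fun s _ => ?_
    have hlead : 720 * σ' 6 6 s - 2 * σ' 2 2 s = 0 := by
      rw [hσ']
      simp only [(hA _ s).1, harmonicSlice_six]
    rw [Finset.sum_range_succ' _ (N + 1), Finset.sum_range_succ' _ (N + 1)]
    have e : Φ h s * h = 720 * ∑ j ∈ Finset.range (N + 1), h ^ (j + 1) * σ' 6 (6 + (j + 1)) s
        - 2 * ∑ j ∈ Finset.range (N + 1), h ^ (j + 1) * σ' 2 (2 + (j + 1)) s := by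
      rw [hΦ]
      simp only [Finset.sum_mul, Finset.mul_sum, ← Finset.sum_sub_distrib]
      exact Finset.sum_congr rfl fun j _ => by ring
    simp only [add_zero, pow_zero, one_mul, pow_one]
    linear_combination w h s * hlead - w h s * e
  have hzero := tendsto_zero_of_isBigO hU one_ne_zero (isBigO_of_pow_mul hU hcomb)
  have hΦlim := tendsto_sum_slice hU hlim Φ fun s => by fun_prop
  -- Since the leading terms cancelled pointwise, only the limit of `w` enters: the Laplace stencil
  -- applied to the first corrections must give zero.
  have hval := tendsto_nhds_unique hΦlim hzero
  have hΦ0 : ∀ s, Φ 0 s = 720 * correctionSlice (partialX D.region a (x₀, D.l₃) / a (x₀, D.l₃))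
      (partialY D.region a (x₀, D.l₃) / a (x₀, D.l₃)) 6 s
      - 2 * correctionSlice (partialX D.region a (x₀, D.l₃) / a (x₀, D.l₃))
      (partialY D.region a (x₀, D.l₃) / a (x₀, D.l₃)) 2 s := fun s => by
    rw [hΦ]
    simp only
    rw [Finset.sum_range_succ', ← (hA 6 s).2.1, ← (hA 2 s).2.1]
    simp [hσ']
  simp only [hΦ0, mul_assoc c, ← Finset.mul_sum, sum_laplaceStencil_correctionSlice_even] at hval
  have ha0 := (ha_pos _ (mem_region_bottom hx₀ hreg)).ne'
  rw [mul_eq_zero] at hval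
  rcases hval with h | h
  · exact hc h
  · have : partialY D.region a (x₀, D.l₃) / a (x₀, D.l₃) = 0 := by linarith
    exact (div_ne_zero hy ha0) this

end SixPointScheme

/-! ### Nontriviality of the constructed schemes and the main theorem -/

lemma neumannScheme_nontrivial {D : InterfaceDomain} {a : ℝ × ℝ → ℝ} {x₀ : ℝ}
    {c : Stencil → Fin 7 → ℝ} (hc : ∃ s, c s 0 ≠ 0) : (neumannScheme D a x₀ c).Nontrivial := by
  obtain ⟨s, hs⟩ := hc
  intro h
  exact hs (tendsto_nhds_unique (tendsto_stencilCoeff c s) (tendsto_pi_nhds.mp h s))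

end
theorem theorem2p3 (D : InterfaceDomain) (a : ℝ × ℝ → ℝ)
    (ha : D.PiecewiseSmooth 6 a) (ha_pos : ∀ z ∈ D.region, 0 < a z)
    (x₀ : ℝ) (hx₀ : x₀ ∈ Ioo D.l₁ D.l₂) (hreg : (x₀, D.l₃) ∉ closure D.interface) :
    -- every nontrivial solution of the linear system gives a scheme of order six
    (∀ c : Stencil → Fin 7 → ℝ, c ≠ 0 → SolvesNeumannSystem D a x₀ c →
      (neumannScheme D a x₀ c).HasOrder D a x₀ 5 4 5 6) ∧
    -- there are solutions whose leading coefficients do not all vanish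
    (∃ c : Stencil → Fin 7 → ℝ, (∃ s, c s 0 ≠ 0) ∧ SolvesNeumannSystem D a x₀ c) ∧
    -- six is the maximum order of six-point schemes with the same data on the right-hand side
    IsGreatest {p : ℕ | ∃ σ : SixPointScheme, σ.Nontrivial ∧ σ.HasOrder D a x₀ 5 4 5 p} 6 ∧
    -- for a smooth coefficient with nonzero normal derivative at the point, derivatives of the
    -- data of higher order do not help
    (D.PiecewiseSmooth ⊤ a → partialY D.region a (x₀, D.l₃) ≠ 0 →
      ∀ (N K p : ℕ) (σ : SixPointScheme), σ.Nontrivial → σ.HasOrder D a x₀ ⊤ N K p → p ≤ 6) := by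
  refine ⟨fun c _ hc => neumannScheme_hasOrder_six ha ha_pos hx₀ hreg hc,
    exists_solvesNeumannSystem D a x₀, ⟨?_, ?_⟩, ?_⟩
  · obtain ⟨c, hc0, hc⟩ := exists_solvesNeumannSystem D a x₀
    exact ⟨neumannScheme D a x₀ c, neumannScheme_nontrivial hc0,
      neumannScheme_hasOrder_six ha ha_pos hx₀ hreg hc⟩
  · rintro p ⟨σ, hnt, hσ⟩
    exact hσ.le_six hnt ha ha_pos hx₀ hreg
  · intro ha' hy N K p σ hnt hσ
    exact hσ.le_six_of_partialY_ne_zero hnt ha' ha_pos hx₀ hreg hy
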